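/- **Setting.** A clause is a finite disjunction of literals, a CNF formula a finite conjunction of clauses. Unit propagation (UP) of a set $A$ of literals on $F$ adds to $A$ every literal of a clause of $F$ all of whose other literals are already false. A CNF formula $F$ (with auxiliary variables) is an *encoding* of a constraint $C$ if an assignment of the variables of $C$ satisfies $C$ iff it can be extended to a model of $F$. It is a *CC encoding* if moreover, for every partial assignment $A$ of the variables of $C$ that cannot be extended to a model of $C$, UP of $A$ on $F$ falsifies a clause. It is a *GAC encoding* if it is a CC encoding and, for every partial assignment $A$ of the variables of $C$ that can be extended to a model of $C$, UP of $A$ on $F$ derives every literal over the variables of $C$ that holds in all models of $C$ extending $A$. Let $P:\sum_{l=1}^n q_lx_l\le K$ be a pseudo-Boolean constraint and $\mathcal X=\{X_1,\dots,X_N\}$ a partition of its variables into nonempty groups, listed in any order; $M_i$ is the at-most-one constraint $\sum_{x\in X_i}x\le1$. Assume the normalisation: $K\ge 1$; $1\le q_l\le K$ are integers; $N>1$; $\sum_i\max_{x_l\in X_i}q_l>K$; two variables of the same group have distinct coefficients. In the formulas below $A\to B$, $A\wedge B\to C$ denote clauses, and auxiliary variables that belong to different formulas are distinct. * **MDD.**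 Take the reduced ordered decision diagram of $P$ in which the nodes of layer $i$ have one child $v_j$ for each $x_j\in X_i$ (choose $x_j$) and an else-child $v_0$ (choose none); isomorphic subdiagrams are identified and nodes with all children equal are removed. With one variable per node: clauses $v\to v_0$, and $v\wedge x_j\to v_j$ if $v_j\ne v_0$, for each nonterminal node $v$; and the unit clauses $v_{\rm root}$, $\overline{v_\bot}$, $v_\top$. * **GSWC.** Variables $s_{i,j}$; clauses $s_{i-1,j}\to s_{i,j}$ ($2\le i<N$, $1\le j\le K$); $x_l\to s_{i,j}$ ($1\le i<N$, $x_l\in X_i$, $1\le j\le q_l$); $s_{i-1,j}\wedge x_l\to s_{i,j+q_l}$ ($2\le i<N$, $x_l\in X_i$, $1\le j\le K-q_l$); $\overline{s_{i-1,K+1-q_l}}\vee\overline{x_l}$ ($2\le i\le N$, $x_l\in X_i$). * **GGT.** Take any binary tree whose leaves are the groups, once each. A leaf $X_i$ has $\mathit{vals}=\{0\}\cup\{q_l: x_l\in X_i\}$, and its variable of value $q_l$ is $x_l$. A nonleaf node $O$ with children $L,R$ has $\mathit{vals}=\{\min(a+b,K+1):a\in L.\mathit{vals},\,b\in R.\mathit{vals}\}$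 and a new variable $o_w$ for each nonzero $w\in O.\mathit{vals}$ (at the root only for $w=K+1$). Clauses, whenever the variables exist: $t_w\to o_w$ for $t\in\{l,r\}$; $l_a\wedge r_b\to o_{\min(a+b,K+1)}$; and the unit clause $\overline{o_{K+1}}$ at the root. * **RGGT.** Repeat until the coefficients no longer change: build any such tree on the current groups, with its sets $\mathit{vals}$; give the root $A$ the intervals $[0,\max(A.\mathit{vals}\setminus\{K+1\})]$ and $[K+1,\infty]$; top-down, give a node $V$ with parent $U$ and sibling $W$ the intervals obtained from the one-point intervals at the elements of $V.\mathit{vals}$ (with $[K+1,\infty]$ for the value $K+1$) by going through adjacent pairs $[a,b],[c,d]$ in ascending order and merging them into $[a,d]$ if for every $w\in W.\mathit{vals}$ some interval of $U$ contains both $w+b$ and $w+c$; then replace each coefficient $q\in(l,u]$ in a leaf having the interval $[l,u]$ by $l$, and delete terms with coefficient $0$ and groups that become empty. Finally, in the tree and with the intervals of the last round, each nonleaf node gets a variable for each interval $[a,b]$ with $a>0$; in a leaf, the interval $[a,a]$, $a>0$, has as variable the unique $x_l$ in the leaf with $q_l=a$ if there is exactly one, and otherwise a new variable implied by each such $x_l$.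 Clauses, for a nonleaf node $O$ with children $L,R$: $t_{a,b}\to o_{e,f}$ if $[a,b]\subseteq[e,f]$ ($t\in\{l,r\}$); $l_{a,b}\wedge r_{c,d}\to o_{e,f}$ if $[a+c,b+d]\subseteq[e,f]$; and the unit clause stating that the root variable of $[K+1,\infty]$ is false. * **Polynomial watchdog $PW(P,\mathcal X)$.** Let $p=\lfloor\log_2\max_l q_l\rfloor$, $T\ge0$ minimal with $2^p\mid K+1+T$, and $m=(K+1+T)/2^p$. For $0\le r\le p$ and each group $X_i$ there is a variable $y_{i,r}$, with clauses $x_l\to y_{i,r}$ for each $x_l\in X_i$ whose coefficient has bit $r$ (optionally $y_{i,r}$ is omitted if there is no such $x_l$, and is $x_l$ itself if there is exactly one). The bucket $B_r$ consists of the $y_{i,r}$ and of a constant $1$ if $T$ has bit $r$. $U(B_r)$ is the unary sum of $B_r$, computed by a totalizer on an arbitrary binary tree with the elements of $B_r$ as leaves; $S_0=U(B_0)$; $S_r$ is the unary sum of $U(B_r)$ and $S_{r-1}^{1/2}$, where $S^{1/2}$ consists of the entries of $S$ at positions $2,4,6,\dots$. A unary sum $o$ of $a$ and $b$ (in each totalizer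 node and for each $S_r$, $r\ge1$) has the clauses $a_i\wedge b_j\to o_{i+j}$ for $0\le i\le|a|$, $0\le j\le|b|$, $i+j\ge1$, and optionally also $\overline{a_{i+1}}\wedge\overline{b_{j+1}}\to\overline{o_{i+j+1}}$ for $0\le i\le|a|$, $0\le j\le|b|$, $i+j<|a|+|b|$, where $a_0=b_0=1$ and $a_{|a|+1}=b_{|b|+1}=0$. The output $w$ is the $m$-th entry of $S_p$ (the constant $0$ if there is none). * **GGPW** is $PW(P,\mathcal X)\wedge\overline w$. * **GLPW** is the conjunction over all $i$ and all $x_l\in X_i$ of $PW(P[x_l,X_i],\mathcal X\setminus\{X_i\})$ and the clause $\overline{w}\vee\overline{x_l}$ with the output $w$ of that formula, where $P[x_l,X_i]$ is $\sum_{x_k\notin X_i}q_kx_k\le K-q_l$. **Theorem.** Let $(P,\mathcal X)$ be as above. 1. If $E$ is any of MDD, GSWC, GGT, RGGT, GLPW and $H$ is a GAC encoding of $M_1\wedge\dots\wedge M_N$ that shares no auxiliary variable with $E(P,\mathcal X)$, then $E(P,\mathcal X)\wedge H$ is a GAC encoding of $P\wedge M_1\wedge\dots\wedge M_N$. 2.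 If $H$ is a CC encoding of $M_1\wedge\dots\wedge M_N$ that shares no auxiliary variable with $\mathrm{GGPW}(P,\mathcal X)$, then $\mathrm{GGPW}(P,\mathcal X)\wedge H$ is a CC encoding of $P\wedge M_1\wedge\dots\wedge M_N$. -/

import Mathlib

/-! ### Propositional formulas in CNF and unit propagation -/

/-- A literal: a variable (`sign = true`) or its negation (`sign = false`). -/
structure Literal (W : Type*) where
  var : W
  sign : Bool

/-- The positive literal of a variable. -/
def pos {W : Type*} (w : W) : Literal W := ⟨w, true⟩

/-- The negative literal of a variable. -/
def neg {W : Type*} (w : W) : Literal W := ⟨w, false⟩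

/-- The complement of a literal. -/
def Literal.compl {W : Type*} (l : Literal W) : Literal W := ⟨l.var, !l.sign⟩

/-- A clause is a (finite) disjunction of literals; only the set of its members matters. -/
abbrev Clause (W : Type*) := List (Literal W)

/-- A formula in CNF is a (finite) conjunction of clauses; only the set of its members matters. -/
abbrev CNF (W : Type*) := List (Clause W)

/-- Renaming of the variables of a formula. -/
def CNF.rename {W W' : Type*} (f : W → W') (F : CNF W) : CNF W' :=
  F.map fun c => c.map fun l => ⟨f l.var, l.sign⟩

/-- The assignment `τ` is a model of `F`. -/
def CNF.Sat {W : Type*} (F : CNF W) (τ : W → Bool) : Prop :=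
  ∀ c ∈ F, ∃ l ∈ c, τ l.var = l.sign

/-- The literals obtained by unit propagating the set of literals `A` on `F`: those of `A`, and every
literal of a clause of `F` all of whose other literals have become false. -/
inductive CNF.UP {W : Type*} (F : CNF W) (A : Set (Literal W)) : Literal W → Prop
  | assumed (l : Literal W) (h : l ∈ A) : CNF.UP F A l
  | propagated (c : Clause W) (l : Literal W) (hc : c ∈ F) (hl : l ∈ c)
      (h : ∀ l' ∈ c, l' ≠ l → CNF.UP F A l'.compl) : CNF.UP F A l

/-- Unit propagating `A` on `F` falsifies some clause of `F`. -/
def CNF.UPConflict {W : Type*} (F : CNF W) (A : Set (Literal W)) : Prop :=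
  ∃ c ∈ F, ∀ l ∈ c, F.UP A l.compl

/-! ### Constraints, encodings, consistency checking, generalized arc consistency

The variables of a constraint are `x : Fin n`. A formula that encodes it has the variables
`Fin n ⊕ α`, where `α` is the type of its auxiliary variables. -/

/-- A constraint (Boolean function) on `n` Boolean variables. -/
abbrev BoolConstraint (n : ℕ) := (Fin n → Bool) → Prop

/-- A partial assignment of the variables of a constraint. -/
abbrev PartialAssignment (n : ℕ) := Fin n → Option Bool

/-- The total assignment `τ` extends the partial assignment `A`. -/
def PartialAssignment.ExtendedBy {n : ℕ} (A : PartialAssignment n) (τ : Fin n → Bool) : Prop :=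
  ∀ x b, A x = some b → τ x = b

/-- A partial assignment seen as a set of literals. -/
def PartialAssignment.lits {n : ℕ} (A : PartialAssignment n) (α : Type*) :
    Set (Literal (Fin n ⊕ α)) :=
  {l | ∃ x b, A x = some b ∧ l = ⟨Sum.inl x, b⟩}

/-- `A` can be extended to a model of `C`. -/
def PartialAssignment.Extendible {n : ℕ} (A : PartialAssignment n) (C : BoolConstraint n) : Prop :=
  ∃ τ, A.ExtendedBy τ ∧ C τ

/-- `F` is an encoding of `C`: an assignment satisfies `C` iff it extends to a model of `F`. -/
def IsEncoding {n : ℕ} {α : Type*} (F : CNF (Fin n ⊕ α)) (C : BoolConstraint n) : Prop :=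
  ∀ τ : Fin n → Bool, C τ ↔ ∃ σ : α → Bool, F.Sat (Sum.elim τ σ)

/-- Consistency checker: on a partial assignment that cannot be extended to a model of `C`, unit
propagation on `F` falsifies some clause. -/
def IsCC {n : ℕ} {α : Type*} (F : CNF (Fin n ⊕ α)) (C : BoolConstraint n) : Prop :=
  ∀ A : PartialAssignment n, ¬ A.Extendible C → F.UPConflict (A.lits α)

/-- Generalized arc consistency: if a variable `x` has the same value `b` in all the extensions of
`A` that satisfy `C`, then unit propagating `A` on `F` assigns `b` to `x`. If there is no such
extension, this means that unit propagation detects the contradiction. -/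
def IsGAC {n : ℕ} {α : Type*} (F : CNF (Fin n ⊕ α)) (C : BoolConstraint n) : Prop :=
  IsCC F C ∧
  ∀ A : PartialAssignment n, A.Extendible C → ∀ (x : Fin n) (b : Bool),
    (∀ τ, A.ExtendedBy τ → C τ → τ x = b) → F.UP (A.lits α) ⟨Sum.inl x, b⟩

def IsCCEncoding {n : ℕ} {α : Type*} (F : CNF (Fin n ⊕ α)) (C : BoolConstraint n) : Prop :=
  IsEncoding F C ∧ IsCC F C

def IsGACEncoding {n : ℕ} {α : Type*} (F : CNF (Fin n ⊕ α)) (C : BoolConstraint n) : Prop :=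
  IsEncoding F C ∧ IsGAC F C

/-- The conjunction of two formulas on the same main variables whose auxiliary variables are kept
disjoint. -/
def CNF.conj {n : ℕ} {α β : Type*} (F : CNF (Fin n ⊕ α)) (G : CNF (Fin n ⊕ β)) :
    CNF (Fin n ⊕ (α ⊕ β)) :=
  F.rename (Sum.map id Sum.inl) ++ G.rename (Sum.map id Sum.inr)

/-! ### PB(AMO) constraints -/

/-- The data of a PB(AMO) constraint: the PB constraint `∑ x, q x * x ≤ K` on the variables
`x : Fin n`, and the ordered family of AMO groups `X i = {x | grp x = i}`, `i : Fin N`. -/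
structure PBAMO (n N : ℕ) where
  q : Fin n → ℕ
  K : ℕ
  grp : Fin n → Fin N

namespace PBAMO

variable {n N : ℕ}

/-- The PB constraint `P`. -/
def pb (P : PBAMO n N) : BoolConstraint n := fun τ => ∑ x, (if τ x then P.q x else 0) ≤ P.K

/-- The conjunction `M_1 ∧ … ∧ M_N` of the AMO constraints. -/
def amos (P : PBAMO n N) : BoolConstraint n := fun τ =>
  ∀ i : Fin N, ∑ x with P.grp x = i, (if τ x then 1 else 0) ≤ 1

/-- The PB(AMO) constraint `P ∧ M_1 ∧ … ∧ M_N`. -/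
def constraint (P : PBAMO n N) : BoolConstraint n := fun τ => P.pb τ ∧ P.amos τ

/-- The standing normalisation assumptions on PB(AMO) constraints (and that the groups are
nonempty, as they form a partition). -/
structure Normalised (P : PBAMO n N) : Prop where
  group_nonempty : ∀ i, ∃ x, P.grp x = i
  K_pos : 0 < P.K
  q_pos : ∀ x, 0 < P.q x
  q_le : ∀ x, P.q x ≤ P.K
  one_lt_N : 1 < N
  not_trivial : P.K < ∑ i : Fin N, (Finset.univ.filter fun x => P.grp x = i).sup P.q
  q_inj : ∀ x y, P.grp x = P.grp y → P.q x = P.q y → x = y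

/-- The variables of group `i`. -/
def group (P : PBAMO n N) (i : Fin N) : List (Fin n) :=
  (List.finRange n).filter fun x => P.grp x = i

end PBAMO

/-! ### MDD -/

/-- Multivalued decision diagrams. A nonterminal node carries its layer `i`, its *else* child, and
the child `sel x` for every selector `x`; for the `x` outside the selectors of the layer, `sel x` is
by convention the *else* child. Isomorphic subdiagrams are equal terms, so that the nodes of the
diagram (with isomorphic subdiagrams identified) are the distinct subterms. -/
inductive MDD (n : ℕ) where
  | bot : MDD n
  | top : MDD n
  | node (i : ℕ) (els : MDD n) (sel : Fin n → MDD n) : MDD n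

namespace MDD

variable {n : ℕ}

def decEq : (a b : MDD n) → Decidable (a = b)
  | bot, bot => isTrue rfl
  | bot, top => isFalse (by simp)
  | bot, node _ _ _ => isFalse (by simp)
  | top, bot => isFalse (by simp)
  | top, top => isTrue rfl
  | top, node _ _ _ => isFalse (by simp)
  | node _ _ _, bot => isFalse (by simp)
  | node _ _ _, top => isFalse (by simp)
  | node i e s, node j e' s' =>
    haveI : Decidable (e = e') := decEq e e'
    haveI : ∀ x, Decidable (s x = s' x) := fun x => decEq (s x) (s' x)
    decidable_of_iff (i = j ∧ e = e' ∧ ∀ x, s x = s' x) (by simp [funext_iff])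

instance : DecidableEq (MDD n) := decEq

/-- A node, unless all its children are the same. -/
def mk (i : ℕ) (els : MDD n) (sel : Fin n → MDD n) : MDD n :=
  if ∀ x, sel x = els then els else node i els sel

/-- The clauses of all the nonterminal nodes. The auxiliary variable of a node is the node itself. -/
def clauses : MDD n → CNF (Fin n ⊕ MDD n)
  | bot => []
  | top => []
  | node i els sel =>
    [pos (Sum.inr els), neg (Sum.inr (node i els sel))] ::
    (((List.finRange n).filter fun x => sel x ≠ els).map fun x =>
      [pos (Sum.inr (sel x)), neg (Sum.inl x), neg (Sum.inr (node i els sel))]) ++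
    clauses els ++ (List.finRange n).flatMap fun x => clauses (sel x)

end MDD

namespace PBAMO

variable {n N : ℕ}

/-- The reduced ordered AMO-MDD of the last `k` groups, when the sum of the previous ones is `c`. -/
def buildMDD (P : PBAMO n N) : ℕ → ℕ → MDD n
  | 0, c => if c ≤ P.K then MDD.top else MDD.bot
  | k + 1, c => MDD.mk (N - (k + 1)) (buildMDD P k c) fun x =>
      if (P.grp x : ℕ) = N - (k + 1) then buildMDD P k (c + P.q x) else buildMDD P k c

/-- The MDD encoding. -/
def mdd (P : PBAMO n N) : CNF (Fin n ⊕ MDD n) :=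
  (P.buildMDD N 0).clauses ++
    [[pos (Sum.inr (P.buildMDD N 0))], [neg (Sum.inr MDD.bot)], [pos (Sum.inr MDD.top)]]

/-! ### GSWC -/

/-- The number in `1, …, N` of the group of `x`. -/
def groupNo (P : PBAMO n N) (x : Fin n) : ℕ := P.grp x + 1

/-- The GSWC encoding. The auxiliary variable `s_{i,j}` is `(i, j)`. -/
def gswc (P : PBAMO n N) : CNF (Fin n ⊕ (ℕ × ℕ)) :=
  (((List.range N).filter fun i => 2 ≤ i).flatMap fun i => (List.range' 1 P.K).map fun j =>
    [neg (Sum.inr (i - 1, j)), pos (Sum.inr (i, j))]) ++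
  (((List.finRange n).filter fun x => P.groupNo x < N).flatMap fun x =>
    (List.range' 1 (P.q x)).map fun j =>
      [neg (Sum.inl x), pos (Sum.inr (P.groupNo x, j))]) ++
  (((List.finRange n).filter fun x => 2 ≤ P.groupNo x ∧ P.groupNo x < N).flatMap fun x =>
    (List.range' 1 (P.K - P.q x)).map fun j =>
      [neg (Sum.inr (P.groupNo x - 1, j)), neg (Sum.inl x),
        pos (Sum.inr (P.groupNo x, j + P.q x))]) ++
  (((List.finRange n).filter fun x => 2 ≤ P.groupNo x).map fun x =>
    [neg (Sum.inr (P.groupNo x - 1, P.K + 1 - P.q x)), neg (Sum.inl x)])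

end PBAMO

/-! ### GGT -/

/-- Binary trees with labelled leaves. -/
inductive BTree (α : Type*) where
  | leaf (a : α) : BTree α
  | node (l r : BTree α) : BTree α

/-- The labels of the leaves, from left to right. When they are distinct, the nodes of the tree
correspond to its subtrees. -/
def BTree.leaves {α : Type*} : BTree α → List α
  | .leaf a => [a]
  | .node l r => l.leaves ++ r.leaves

namespace PBAMO

variable {n N : ℕ}

/-- The attribute *vals* of a node: the possible values of its sum, those over `K` counted as
`K + 1`. -/
def vals (P : PBAMO n N) : BTree (Fin N) → Finset ℕ
  | .leaf i => insert 0 ((Finset.univ.filter fun x => P.grp x = i).image P.q)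
  | .node l r => Finset.image₂ (fun a b => min (a + b) (P.K + 1)) (vals P l) (vals P r)

/-- The attribute *vars* of a node, as a list of pairs of a value and the variable of that value. In
a leaf these are the variables of the group, in a nonleaf node `O` the auxiliary variables
`o_w = (O, w)`. -/
def ggtVars (P : PBAMO n N) : BTree (Fin N) → List (ℕ × (Fin n ⊕ (BTree (Fin N) × ℕ)))
  | .leaf i => (P.group i).map fun x => (P.q x, Sum.inl x)
  | .node l r => ((P.vals (.node l r)).erase 0).sort.map fun w => (w, Sum.inr (.node l r, w))

/-- The clauses of the nonleaf node with children `l` and `r` whose last literal is a variable `o_w`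
with `keep w`. -/
def ggtNode (P : PBAMO n N) (l r : BTree (Fin N)) (keep : ℕ → Bool) :
    CNF (Fin n ⊕ (BTree (Fin N) × ℕ)) :=
  (((P.ggtVars l ++ P.ggtVars r).filter fun t => keep t.1).map fun t =>
    [neg t.2, pos (Sum.inr (.node l r, t.1))]) ++
  (((P.ggtVars l ×ˢ P.ggtVars r).filter fun t => keep (min (t.1.1 + t.2.1) (P.K + 1))).map fun t =>
    [neg t.1.2, neg t.2.2, pos (Sum.inr (.node l r, min (t.1.1 + t.2.1) (P.K + 1)))])

/-- The clauses of all the nonleaf nodes of a tree. -/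
def ggtClauses (P : PBAMO n N) : BTree (Fin N) → CNF (Fin n ⊕ (BTree (Fin N) × ℕ))
  | .leaf _ => []
  | .node l r => P.ggtNode l r (fun _ => true) ++ ggtClauses P l ++ ggtClauses P r

/-- The GGT encoding on a given tree. At the root only the variable of the value `K + 1` and its
clauses are introduced. (With at least two groups, the tree is not a leaf.) -/
def ggt (P : PBAMO n N) : BTree (Fin N) → CNF (Fin n ⊕ (BTree (Fin N) × ℕ))
  | .leaf _ => []
  | .node l r => P.ggtNode l r (fun w => w = P.K + 1) ++ P.ggtClauses l ++ P.ggtClauses r ++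
      [[neg (Sum.inr (.node l r, P.K + 1))]]

end PBAMO

/-! ### RGGT -/

/-- The interval `[lo, hi]` of integers. -/
structure Itv where
  lo : ℕ
  hi : WithTop ℕ

def Itv.Mem (v : WithTop ℕ) (I : Itv) : Prop := (I.lo : WithTop ℕ) ≤ v ∧ v ≤ I.hi

instance (v : WithTop ℕ) (I : Itv) : Decidable (Itv.Mem v I) :=
  inferInstanceAs (Decidable (_ ∧ _))

/-- Go through a list of intervals in ascending order and replace adjacent intervals `[a, b]`,
`[c, d]` such that `same b c` by `[a, d]`. -/
def mergeItvs (same : WithTop ℕ → ℕ → Bool) : List Itv → List Itv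
  | [] => []
  | [I] => [I]
  | I :: J :: L =>
    if same I.hi J.lo then mergeItvs same (⟨I.lo, J.hi⟩ :: L)
    else I :: mergeItvs same (J :: L)
  termination_by L => L.length

namespace PBAMO

variable {n N : ℕ}

/-- The constraint obtained by replacing the coefficients. A term with coefficient `0` counts as
deleted, and so does a group that has only such terms. -/
def withCoeffs (P : PBAMO n N) (q : Fin n → ℕ) : PBAMO n N := { P with q := q }

/-- The groups that are not deleted. -/
def liveGroups (P : PBAMO n N) : List (Fin N) :=
  (List.finRange N).filter fun i => ∃ x, P.grp x = i ∧ 0 < P.q x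

/-- The intervals of the root. -/
def rootItvs (P : PBAMO n N) (t : BTree (Fin N)) : List Itv :=
  [⟨0, (((P.vals t).erase (P.K + 1)).sup id : ℕ)⟩, ⟨P.K + 1, ⊤⟩]

/-- The intervals of the node `v` with sibling `w`, from the intervals `U` of its parent. -/
def childItvs (P : PBAMO n N) (U : List Itv) (v w : BTree (Fin N)) : List Itv :=
  mergeItvs (fun b c => ∀ a ∈ P.vals w, ∃ I ∈ U, Itv.Mem (a + b) I ∧ Itv.Mem (a + c : ℕ) I)
    ((P.vals v).sort.map fun a => ⟨a, if a < P.K + 1 then (a : WithTop ℕ) else ⊤⟩)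

/-- The new coefficient of `x` after one pass of the reduction, where `U` are the intervals of the
root of the tree: a coefficient in `(l, u]`, for an interval `[l, u]` of its leaf, becomes `l`. -/
def newCoeff (P : PBAMO n N) (x : Fin n) : List Itv → BTree (Fin N) → ℕ
  | U, .leaf i =>
    if P.grp x = i then
      match U.find? fun I => I.lo < P.q x ∧ (P.q x : WithTop ℕ) ≤ I.hi with
      | some I => I.lo
      | none => P.q x
    else P.q x
  | U, .node l r =>
    if P.grp x ∈ l.leaves then newCoeff P x (P.childItvs U l r) l
    else newCoeff P x (P.childItvs U r l) r

/-- One pass of the reduction on the tree `t`. -/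
def rggtPass (P : PBAMO n N) (t : BTree (Fin N)) : PBAMO n N :=
  P.withCoeffs fun x => P.newCoeff x (P.rootItvs t) t

theorem newCoeff_le (P : PBAMO n N) (x : Fin n) (U : List Itv) (t : BTree (Fin N)) :
    P.newCoeff x U t ≤ P.q x := by
  induction t generalizing U with
  | leaf i =>
    unfold newCoeff
    split_ifs
    · split
      · rename_i I h
        have h' := List.find?_some h
        simp only [decide_eq_true_eq] at h'
        exact h'.1.le
      · exact le_rfl
    · exact le_rfl
  | node l r hl hr =>
    unfold newCoeff
    split_ifs
    · exact hl _
    · exact hr _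

/-- The final constraint of the reduction algorithm, where `build` is the heuristic that builds the
trees: passes are repeated as long as they change the constraint. -/
def rggtReduce (build : PBAMO n N → BTree (Fin N)) (P : PBAMO n N) : PBAMO n N :=
  if (P.rggtPass (build P)).q = P.q then P else rggtReduce build (P.rggtPass (build P))
  termination_by ∑ x, P.q x
  decreasing_by
    rename_i h
    obtain ⟨x, hx⟩ := Function.ne_iff.mp h
    exact Finset.sum_lt_sum (fun y _ => P.newCoeff_le y _ _)
      ⟨x, Finset.mem_univ x, lt_of_le_of_ne (P.newCoeff_le x _ _) hx⟩

/-- The terms of group `i` with coefficient `a`. -/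
def termsWith (P : PBAMO n N) (i : Fin N) (a : ℕ) : List (Fin n) :=
  (P.group i).filter fun x => P.q x = a

/-- The attribute *vars* of a node with intervals `U`, as a list of pairs of an interval and its
variable. -/
def rggtVars (P : PBAMO n N) (U : List Itv) :
    BTree (Fin N) → List (Itv × (Fin n ⊕ (BTree (Fin N) × Itv)))
  | .leaf i => (U.filter fun I => 0 < I.lo).map fun I =>
      match P.termsWith i I.lo with
      | [x] => (I, Sum.inl x)
      | _ => (I, Sum.inr (.leaf i, I))
  | .node l r => (U.filter fun I => 0 < I.lo).map fun I => (I, Sum.inr (.node l r, I))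

/-- The clauses of a tree whose root has intervals `U`. -/
def rggtClauses (P : PBAMO n N) : List Itv → BTree (Fin N) → CNF (Fin n ⊕ (BTree (Fin N) × Itv))
  | U, .leaf i => (U.filter fun I => 0 < I.lo).flatMap fun I =>
      match P.termsWith i I.lo with
      | [_] => []
      | L => L.map fun x => [neg (Sum.inl x), pos (Sum.inr (.leaf i, I))]
  | U, .node l r =>
    let L := P.rggtVars (P.childItvs U l r) l
    let R := P.rggtVars (P.childItvs U r l) r
    let O := P.rggtVars U (.node l r)
    (((L ++ R) ×ˢ O).filter fun t => t.2.1.lo ≤ t.1.1.lo ∧ t.1.1.hi ≤ t.2.1.hi).map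
      (fun t => [neg t.1.2, pos t.2.2]) ++
    (((L ×ˢ R) ×ˢ O).filter fun t =>
        t.2.1.lo ≤ t.1.1.1.lo + t.1.2.1.lo ∧ t.1.1.1.hi + t.1.2.1.hi ≤ t.2.1.hi).map
      (fun t => [neg t.1.1.2, neg t.1.2.2, pos t.2.2]) ++
    rggtClauses P (P.childItvs U l r) l ++ rggtClauses P (P.childItvs U r l) r

/-- The RGGT encoding of a constraint that the reduction no longer changes, on the tree `t`. -/
def rggtOfTree (P : PBAMO n N) (t : BTree (Fin N)) : CNF (Fin n ⊕ (BTree (Fin N) × Itv)) :=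
  P.rggtClauses (P.rootItvs t) t ++ [[neg (Sum.inr (t, ⟨P.K + 1, ⊤⟩))]]

/-- The RGGT encoding, where `build` is the heuristic that builds the trees. -/
def rggt (P : PBAMO n N) (build : PBAMO n N → BTree (Fin N)) :
    CNF (Fin n ⊕ (BTree (Fin N) × Itv)) :=
  (rggtReduce build P).rggtOfTree (build (rggtReduce build P))

end PBAMO

/-! ### Polynomial watchdogs: GGPW and GLPW -/

/-- An input of a circuit: the constant `1` or a variable. -/
inductive Wire (W : Type*) where
  | one : Wire W
  | var (w : W) : Wire W

/-- The literals of the negation of a wire (the negation of `1` is false, so it is omitted). -/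
def Wire.negLits {W : Type*} : Wire W → Clause W
  | .one => []
  | .var w => [neg w]

/-- The clause formed by the wires in `L` and the literals in `c`; it is omitted if it is trivially
true because `L` contains the constant `1`. -/
def posClause {W : Type*} (L : List (Wire W)) (c : Clause W) : CNF W :=
  if L.any fun v => match v with | .one => true | .var _ => false then []
  else [(L.flatMap fun v => match v with | .one => [] | .var w => [pos w]) ++ c]

/-- The adder of the unary numbers `a = ⟨a_1, …⟩` and `b = ⟨b_1, …⟩`, with output `o 1, o 2, …`: the
clauses `a_i ∧ b_j → o (i + j)` and, if `both`, the clauses `¬a_{i+1} ∧ ¬b_{j+1} → ¬o (i + j + 1)`,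
for `0 ≤ i ≤ |a|` and `0 ≤ j ≤ |b|`, where `a_0 = b_0 = 1` and `a_{|a|+1} = b_{|b|+1} = 0`. -/
def unaryAdder {W : Type*} (both : Bool) (a b : List (Wire W)) (o : ℕ → W) : CNF W :=
  (List.range (a.length + 1) ×ˢ List.range (b.length + 1)).flatMap fun t =>
    (if t.1 + t.2 = 0 then [] else
      [((Wire.one :: a).getD t.1 Wire.one).negLits ++ ((Wire.one :: b).getD t.2 Wire.one).negLits ++
        [pos (o (t.1 + t.2))]]) ++
    (if both = true ∧ t.1 + t.2 < a.length + b.length then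
      posClause ((a[t.1]?).toList ++ (b[t.2]?).toList) [neg (o (t.1 + t.2 + 1))] else [])

/-- The auxiliary variables of a polynomial watchdog: `y_{i,r}`, the `k`-th output of a node `t` of
the totalizer of bucket `r`, and the `k`-th element of `S_r`. A bucket consists of the variables
`y_{i,r}`, represented by `some i`, and possibly of the constant `1`, represented by `none`. -/
inductive PWVar (N : ℕ) where
  | y (i : Fin N) (r : ℕ) : PWVar N
  | tot (r : ℕ) (t : BTree (Option (Fin N))) (k : ℕ) : PWVar N
  | s (r k : ℕ) : PWVar N

/-- A polynomial watchdog formula is determined by a PB(AMO) constraint `P`, of which only the groups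
in `G` are kept, with the right hand side `K` instead of that of `P`; by the trees `tree r` of the
totalizers of the buckets; and by two choices of implementation: `opt` says whether variables
`y_{i,r}` are replaced by simpler ones where they are implied by at most one variable, `both` whether
totalizers and adders contain the clauses for both directions. -/
structure PW (n N : ℕ) where
  P : PBAMO n N
  G : Finset (Fin N)
  K : ℕ
  opt : Bool
  both : Bool
  tree : ℕ → BTree (Option (Fin N))

namespace PW

variable {n N : ℕ}

/-- The index of the most significant bit of the largest coefficient. -/
def p (D : PW n N) : ℕ :=
  Nat.log 2 ((Finset.univ.filter fun x => D.P.grp x ∈ D.G).sup D.P.q)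

/-- The smallest natural number such that `K + 1 + T` is a multiple of `2 ^ p`. -/
def T (D : PW n N) : ℕ := (2 ^ D.p - (D.K + 1) % 2 ^ D.p) % 2 ^ D.p

def m (D : PW n N) : ℕ := (D.K + 1 + D.T) / 2 ^ D.p

/-- The variables of group `i` whose coefficient has bit `r`. -/
def bitVars (D : PW n N) (i : Fin N) (r : ℕ) : List (Fin n) :=
  (D.P.group i).filter fun x => (D.P.q x).testBit r

/-- The variable that plays the role of `y_{i,r}`, if there is one. -/
def yVar (D : PW n N) (i : Fin N) (r : ℕ) : Option (Fin n ⊕ PWVar N) :=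
  if D.opt then
    match D.bitVars i r with
    | [] => none
    | [x] => some (Sum.inl x)
    | _ => some (Sum.inr (.y i r))
  else some (Sum.inr (.y i r))

/-- The clauses that define `y_{i,r}`, if it is a new variable. -/
def yClauses (D : PW n N) (i : Fin N) (r : ℕ) : CNF (Fin n ⊕ PWVar N) :=
  if D.opt = true ∧ (D.bitVars i r).length ≤ 1 then []
  else (D.bitVars i r).map fun x => [neg (Sum.inl x), pos (Sum.inr (.y i r))]

/-- The bucket `B_r`. -/
def bucket (D : PW n N) (r : ℕ) : List (Option (Fin N)) :=
  (if D.T.testBit r then [none] else []) ++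
    ((List.finRange N).filter fun i => i ∈ D.G ∧ (D.yVar i r).isSome).map some

/-- The trees of the totalizers have the elements of the buckets at their leaves, in some order. (An
empty bucket has no totalizer.) -/
def TreesOK (D : PW n N) : Prop :=
  ∀ r ≤ D.p, D.bucket r ≠ [] → (D.tree r).leaves.Perm (D.bucket r)

/-- The output of a node of the totalizer of bucket `r`. -/
def totOut (D : PW n N) (r : ℕ) : BTree (Option (Fin N)) → List (Wire (Fin n ⊕ PWVar N))
  | .leaf none => [.one]
  | .leaf (some i) => ((D.yVar i r).map Wire.var).toList
  | .node a b => (List.range' 1 (BTree.node a b).leaves.length).map fun k =>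
      .var (Sum.inr (.tot r (.node a b) k))

/-- The clauses of the totalizer of bucket `r`. -/
def totClauses (D : PW n N) (r : ℕ) : BTree (Option (Fin N)) → CNF (Fin n ⊕ PWVar N)
  | .leaf _ => []
  | .node a b =>
    unaryAdder D.both (D.totOut r a) (D.totOut r b) (fun k => Sum.inr (.tot r (.node a b) k)) ++
      totClauses D r a ++ totClauses D r b

/-- The formula `φ(B_r)`. -/
def phi (D : PW n N) (r : ℕ) : CNF (Fin n ⊕ PWVar N) :=
  if D.bucket r = [] then [] else D.totClauses r (D.tree r)

/-- The output `U(B_r)` of `φ(B_r)`. -/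
def U (D : PW n N) (r : ℕ) : List (Wire (Fin n ⊕ PWVar N)) :=
  if D.bucket r = [] then [] else D.totOut r (D.tree r)

/-- Half of a unary number: its elements of index `2, 4, 6, …` (indices start from 1). -/
def half {W : Type*} (L : List W) : List W :=
  (List.range (L.length / 2)).filterMap fun k => L[2 * k + 1]?

/-- The vector `S_r`. -/
def S (D : PW n N) : ℕ → List (Wire (Fin n ⊕ PWVar N))
  | 0 => D.U 0
  | r + 1 => (List.range' 1 ((D.U (r + 1)).length + (half (S D r)).length)).map fun k =>
      .var (Sum.inr (.s (r + 1) k))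

/-- The formula `ψ(U(B_r), S_{r-1}^{1/2})`, for `r ≥ 1`. -/
def psi (D : PW n N) (r : ℕ) : CNF (Fin n ⊕ PWVar N) :=
  unaryAdder D.both (D.U r) (half (D.S (r - 1))) fun k => Sum.inr (.s r k)

/-- The polynomial watchdog formula. -/
def formula (D : PW n N) : CNF (Fin n ⊕ PWVar N) :=
  ((List.range (D.p + 1)).flatMap fun r => D.phi r) ++
  ((List.range' 1 D.p).flatMap fun r => D.psi r) ++
  ((List.range (D.p + 1)).flatMap fun r =>
    ((List.finRange N).filter fun i => i ∈ D.G).flatMap fun i => D.yClauses i r)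

/-- The clauses stating that the output `w`, the `m`-th element of `S_p`, is false or `c` holds. There
is no such clause if `S_p` has less than `m` elements: then the sum cannot reach `m * 2 ^ p`. -/
def notOutput (D : PW n N) (c : Clause (Fin n ⊕ PWVar N)) : CNF (Fin n ⊕ PWVar N) :=
  match (D.S D.p)[D.m - 1]? with
  | none => []
  | some w => [w.negLits ++ c]

end PW

namespace PBAMO

variable {n N : ℕ}

/-- The polynomial watchdog of `(P, X)`. -/
def watchdog (P : PBAMO n N) (opt both : Bool) (tree : ℕ → BTree (Option (Fin N))) : PW n N :=
  { P := P, G := Finset.univ, K := P.K, opt := opt, both := both, tree := tree }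

/-- The GGPW encoding. -/
def ggpw (P : PBAMO n N) (opt both : Bool) (tree : ℕ → BTree (Option (Fin N))) :
    CNF (Fin n ⊕ PWVar N) :=
  (P.watchdog opt both tree).formula ++ (P.watchdog opt both tree).notOutput []

/-- The polynomial watchdog of `(P[x, X_i], X ∖ {X_i})`, where `x ∈ X_i`. -/
def localWatchdog (P : PBAMO n N) (opt both : Bool) (tree : ℕ → BTree (Option (Fin N)))
    (x : Fin n) : PW n N :=
  { P := P, G := Finset.univ.erase (P.grp x), K := P.K - P.q x, opt := opt, both := both,
    tree := tree }

/-- The GLPW encoding. The auxiliary variables of the polynomial watchdog that belongs to `x` are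
the pairs with first component `x`. -/
def glpw (P : PBAMO n N) (opt both : Bool) (tree : Fin n → ℕ → BTree (Option (Fin N))) :
    CNF (Fin n ⊕ (Fin n × PWVar N)) :=
  (List.finRange n).flatMap fun x =>
    ((P.localWatchdog opt both (tree x) x).formula ++
      (P.localWatchdog opt both (tree x) x).notOutput [neg (Sum.inl x)]).rename
        (Sum.map id (Prod.mk x))

end PBAMO

/-! ### Unit propagation -/

namespace Literal

variable {W : Type*}

/-! An assignment satisfying the AMO constraints is a choice of at most one variable per group. If a
partial assignment is compatible with these constraints, setting every unassigned variable to false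
gives its extension of least load, so the extensions that satisfy everything exist iff this choice
has load at most `K`. This separates the PB formula from `H`: the former must be satisfiable on the
fitting choices (`Sound`), produce a conflict on the overfull ones (`Detects`), and, for arc
consistency, refute `x` from the other members of an overfull choice containing `x` (`Refutes`,
which implies `Detects`). An unassigned variable can only be forced to false: either its group
already has a true variable, and `H` propagates this, or adding it overfills the choice
(`isGACEncoding_conj`).

`Refutes` rests on running clauses backwards. On the way from the chosen variables to the overflow,
every variable is either propagated outright or linked to `x` by a chain along which its falsity
propagates back to the falsity of `x`; `Der` records this alternative. A clause with two premises
preserves it as long as at most one premise is linked (`Der.imp₂`). MDD, GSWC, GGT and RGGT read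
each group only once, along a path or in a tree, so two linked premises never meet, and the final
negative clause sends falsity back to `x`. In GLPW the watchdog of `x` does not read the group of
`x`: forward propagation yields its output, and the clause with the negation of `x` finishes. In
GGPW a single variable may feed several buckets, which breaks this linearity; only detection is
shown.

It remains to see that propagation computes the right sums. The auxiliary variables state lower
bounds on partial loads, which gives soundness and guides the derivations. For RGGT, merged values
are indistinguishable to the parent whatever the sibling contributes, so a reduction pass keeps the
same fitting choices (`sum_load_rggtPass_le_iff`), and at the fixed point every coefficient is the
lower end of its interval. For the watchdogs, repeated halving makes `S_p` the quotient of `T` plus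
the load by `2 ^ p` (`sVal_eq`), and this reaches `m` exactly when the load exceeds `K`
(`m_le_sVal_iff`). -/

@[simp] theorem compl_compl (l : Literal W) : l.compl.compl = l := by
  simp [Literal.compl]

@[simp] theorem compl_pos (w : W) : (pos w).compl = neg w := rfl

@[simp] theorem compl_neg (w : W) : (neg w).compl = pos w := rfl

theorem pos_ne_neg (v w : W) : pos v ≠ neg w := by
  simp [pos, neg]

end Literal

namespace CNF

variable {W W' : Type*}

theorem UP.mono {F F' : CNF W} {A A' : Set (Literal W)} (hF : F ⊆ F') (hA : A ⊆ A')
    {l : Literal W} (h : F.UP A l) : F'.UP A' l := by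
  induction h with
  | assumed l h => exact .assumed l (hA h)
  | propagated c l hc hl _ ih => exact .propagated c l (hF hc) hl ih

theorem UPConflict.mono {F F' : CNF W} {A A' : Set (Literal W)} (hF : F ⊆ F') (hA : A ⊆ A')
    (h : F.UPConflict A) : F'.UPConflict A' := by
  obtain ⟨c, hc, h⟩ := h
  exact ⟨c, hF hc, fun l hl => (h l hl).mono hF hA⟩

/-- Renaming of the variable of a literal. -/
def _root_.Literal.rename (f : W → W') (l : Literal W) : Literal W' := ⟨f l.var, l.sign⟩

theorem UP.rename (f : W → W') {F : CNF W} {A : Set (Literal W)} {l : Literal W}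
    (h : F.UP A l) : (F.rename f).UP (Literal.rename f '' A) (l.rename f) := by
  induction h with
  | assumed l h => exact .assumed _ ⟨l, h, rfl⟩
  | propagated c l hc hl _ ih =>
    refine .propagated (c.map (Literal.rename f)) _ (List.mem_map.2 ⟨c, hc, rfl⟩)
      (List.mem_map_of_mem hl) ?_
    intro l' hl' hne
    obtain ⟨l₀, h₀, rfl⟩ := List.mem_map.1 hl'
    exact ih l₀ h₀ fun h => hne (h ▸ rfl)

theorem UPConflict.rename (f : W → W') {F : CNF W} {A : Set (Literal W)}
    (h : F.UPConflict A) : (F.rename f).UPConflict (Literal.rename f '' A) := by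
  obtain ⟨c, hc, h⟩ := h
  refine ⟨c.map (Literal.rename f), List.mem_map.2 ⟨c, hc, rfl⟩, fun l hl => ?_⟩
  obtain ⟨l₀, h₀, rfl⟩ := List.mem_map.1 hl
  exact (h l₀ h₀).rename f

theorem sat_rename (f : W → W') (F : CNF W) (τ : W' → Bool) :
    (F.rename f).Sat τ ↔ F.Sat (τ ∘ f) := by
  simp [CNF.Sat, CNF.rename]

theorem sat_append (F G : CNF W) (τ : W → Bool) : Sat (F ++ G) τ ↔ F.Sat τ ∧ G.Sat τ := by
  simp [CNF.Sat, or_imp, forall_and]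

theorem UP.sound {F : CNF W} {A : Set (Literal W)} {τ : W → Bool} (hF : F.Sat τ)
    (hA : ∀ l ∈ A, τ l.var = l.sign) {l : Literal W} (h : F.UP A l) : τ l.var = l.sign := by
  induction h with
  | assumed l h => exact hA l h
  | propagated c l hc hl _ ih =>
    obtain ⟨l', hl', h'⟩ := hF c hc
    by_cases hll : l' = l
    · exact hll ▸ h'
    · have := ih l' hl' hll
      simp [Literal.compl, h'] at this

theorem not_upConflict_of_sat {F : CNF W} {A : Set (Literal W)} {τ : W → Bool} (hF : F.Sat τ)
    (hA : ∀ l ∈ A, τ l.var = l.sign) : ¬ F.UPConflict A := by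
  rintro ⟨c, hc, h⟩
  obtain ⟨l, hl, h'⟩ := hF c hc
  have := (h l hl).sound hF hA
  simp [Literal.compl, h'] at this

/-- The clause that produced the complement is the falsified one: its other literals were already
false, and `l` falsifies the last. If the complement were merely assumed, there might be no such
clause. -/
theorem upConflict_of_up_compl {F : CNF W} {A : Set (Literal W)} {l : Literal W}
    (h : F.UP A l) (h' : F.UP A l.compl) (hl : l.compl ∉ A) : F.UPConflict A := by
  cases h' with
  | assumed _ h => exact absurd h hl
  | propagated c _ hc hlc ih =>
    refine ⟨c, hc, fun l' hl' => ?_⟩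
    by_cases hll : l' = l.compl
    · simpa [hll] using h
    · exact ih l' hl' hll

/-- The variable `w` is derived by unit propagation or, if `b`, it is linearly implied by `g`: once
`w` is found to be false, so is `g`. -/
def Der (F : CNF W) (A : Set (Literal W)) (g : Literal W) (b : Bool) (w : W) : Prop :=
  F.UP A (pos w) ∨ (b = true ∧ (F.UP A (neg w) → F.UP A g.compl))

/-! ### Forward and backward use of clauses: linear implication. -/

section Der

variable {F : CNF W} {A : Set (Literal W)} {g : Literal W} {u v : Bool} {o p q w : W}

theorem der_false : F.Der A g false w ↔ F.UP A (pos w) := by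
  simp [Der]

theorem Der.of_up (h : F.UP A (pos w)) : F.Der A g u w := .inl h

/-- The clause is used forwards if `p` has been propagated, and contrapositively if `p` is only
linked to `g`. Describing the clause by its members makes the order of its literals irrelevant. -/
theorem Der.imp {c : Clause W} (hp : F.Der A g u p) (hc : c ∈ F) (hoc : pos o ∈ c)
    (hpc : neg p ∈ c) (h : ∀ l ∈ c, l = pos o ∨ l = neg p) : F.Der A g u o := by
  rcases hp with hp | ⟨hu, hp⟩
  · refine .inl (.propagated c _ hc hoc fun l hl hne => ?_)
    rcases h l hl with rfl | rfl
    · exact absurd rfl hne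
    · exact hp
  · refine .inr ⟨hu, fun ho => hp (.propagated c _ hc hpc fun l hl hne => ?_)⟩
    rcases h l hl with rfl | rfl
    · exact ho
    · exact absurd rfl hne

/-- If one premise is propagated, the clause behaves like an implication from the other one, which
can be reversed. With two linked premises, the falsity of `o` would leave two open literals and
propagation would stop; `huv` excludes this. -/
theorem Der.imp₂ {c : Clause W} (hp : F.Der A g u p) (hq : F.Der A g v q) (huv : ¬ (u ∧ v))
    (hc : c ∈ F) (hoc : pos o ∈ c) (hpc : neg p ∈ c) (hqc : neg q ∈ c)
    (h : ∀ l ∈ c, l = pos o ∨ l = neg p ∨ l = neg q) : F.Der A g (u || v) o := by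
  rcases hp with hp | ⟨hu, hp⟩
  · rcases hq with hq | ⟨hv, hq⟩
    · refine .inl (.propagated c _ hc hoc fun l hl hne => ?_)
      rcases h l hl with rfl | rfl | rfl
      exacts [absurd rfl hne, hp, hq]
    · refine .inr ⟨by simp [hv], fun ho => hq (.propagated c _ hc hqc fun l hl hne => ?_)⟩
      rcases h l hl with rfl | rfl | rfl
      exacts [ho, hp, absurd rfl hne]
  · rcases hq with hq | ⟨hv, hq⟩
    · refine .inr ⟨by simp [hu], fun ho => hp (.propagated c _ hc hpc fun l hl hne => ?_)⟩
      rcases h l hl with rfl | rfl | rfl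
      exacts [ho, absurd rfl hne, hq]
    · exact absurd ⟨hu, hv⟩ huv

theorem Der.weaken (hp : F.Der A g u p) (h : u → v) : F.Der A g v p :=
  hp.imp_right fun h' => ⟨h h'.1, h'.2⟩

/-- The turning point of a refutation: a forbidden variable either is a conflict, if it was
propagated, or starts the chain back to `g`. -/
theorem Der.refute (hp : F.Der A g u p) (hc : [neg p] ∈ F) :
    F.UP A g.compl ∨ F.UPConflict A := by
  rcases hp with hp | ⟨_, hp⟩
  · exact .inr ⟨_, hc, by simpa using hp⟩
  · exact .inl (hp (.propagated _ _ hc (by simp) (by simp)))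

theorem Der.refute₂ (hp : F.Der A g u p) (hq : F.Der A g v q) (huv : ¬ (u ∧ v))
    (hc : [neg p, neg q] ∈ F) : F.UP A g.compl ∨ F.UPConflict A := by
  rcases hp with hp | ⟨hu, hp⟩
  · rcases hq with hq | ⟨hv, hq⟩
    · exact .inr ⟨_, hc, by simpa using ⟨hp, hq⟩⟩
    · refine .inl (hq (.propagated _ _ hc (by simp) fun l hl hne => ?_))
      rcases List.mem_pair.1 hl with rfl | rfl
      exacts [hp, absurd rfl hne]
  · rcases hq with hq | ⟨hv, hq⟩
    · refine .inl (hp (.propagated _ _ hc (by simp) fun l hl hne => ?_))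
      rcases List.mem_pair.1 hl with rfl | rfl
      exacts [absurd rfl hne, hq]
    · exact absurd ⟨hu, hv⟩ huv

end Der

/-! ### Conjunction of formulas with disjoint auxiliary variables. -/

variable {n : ℕ} {α β : Type*}

theorem sat_conj (F : CNF (Fin n ⊕ α)) (G : CNF (Fin n ⊕ β)) (τ : Fin n → Bool)
    (σ : α ⊕ β → Bool) :
    (F.conj G).Sat (Sum.elim τ σ) ↔
      F.Sat (Sum.elim τ (σ ∘ Sum.inl)) ∧ G.Sat (Sum.elim τ (σ ∘ Sum.inr)) := by
  rw [CNF.conj, sat_append, sat_rename, sat_rename]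
  simp only [Sum.elim_comp_map, Function.comp_id]

theorem rename_lits_left (A : PartialAssignment n) :
    Literal.rename (Sum.map id Sum.inl) '' A.lits α ⊆ A.lits (α ⊕ β) := by
  rintro _ ⟨_, ⟨x, b, h, rfl⟩, rfl⟩
  exact ⟨x, b, h, rfl⟩

theorem rename_lits_right (A : PartialAssignment n) :
    Literal.rename (Sum.map id Sum.inr) '' A.lits β ⊆ A.lits (α ⊕ β) := by
  rintro _ ⟨_, ⟨x, b, h, rfl⟩, rfl⟩
  exact ⟨x, b, h, rfl⟩

variable {F : CNF (Fin n ⊕ α)} {G : CNF (Fin n ⊕ β)} {A : PartialAssignment n}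

theorem UP.conj_left {x : Fin n} {b : Bool} (h : F.UP (A.lits α) ⟨Sum.inl x, b⟩) :
    (F.conj G).UP (A.lits (α ⊕ β)) ⟨Sum.inl x, b⟩ :=
  (h.rename (Sum.map id Sum.inl)).mono (List.subset_append_left _ _) (rename_lits_left A)

theorem UP.conj_right {x : Fin n} {b : Bool} (h : G.UP (A.lits β) ⟨Sum.inl x, b⟩) :
    (F.conj G).UP (A.lits (α ⊕ β)) ⟨Sum.inl x, b⟩ :=
  (h.rename (Sum.map id Sum.inr)).mono (List.subset_append_right _ _) (rename_lits_right A)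

theorem UPConflict.conj_left (h : F.UPConflict (A.lits α)) :
    (F.conj G).UPConflict (A.lits (α ⊕ β)) :=
  (h.rename (Sum.map id Sum.inl)).mono (List.subset_append_left _ _) (rename_lits_left A)

theorem UPConflict.conj_right (h : G.UPConflict (A.lits β)) :
    (F.conj G).UPConflict (A.lits (α ⊕ β)) :=
  (h.rename (Sum.map id Sum.inr)).mono (List.subset_append_right _ _) (rename_lits_right A)

end CNF

/-! ### Choices of at most one variable per group -/

namespace PBAMO

variable {n N : ℕ} {α β : Type*}

/-- `c` chooses at most one variable of every group. -/
def IsChoice (P : PBAMO n N) (c : Fin N → Option (Fin n)) : Prop :=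
  ∀ i x, c i = some x → P.grp x = i

/-- The coefficient of the variable chosen in group `i`. -/
def load (P : PBAMO n N) (c : Fin N → Option (Fin n)) (i : Fin N) : ℕ := (c i).elim 0 P.q

/-- The assignment in which exactly the chosen variables are true. -/
def assignment (P : PBAMO n N) (c : Fin N → Option (Fin n)) : Fin n → Bool :=
  fun x => c (P.grp x) = some x

/-- The positive literals of the chosen variables. -/
def chosen (c : Fin N → Option (Fin n)) (α : Type*) : Set (Literal (Fin n ⊕ α)) :=
  {l | ∃ i x, c i = some x ∧ l = pos (Sum.inl x)}

variable {P : PBAMO n N} {c : Fin N → Option (Fin n)}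

theorem assignment_eq_true {x : Fin n} : P.assignment c x = true ↔ c (P.grp x) = some x := by
  simp [assignment]

theorem sum_group_assignment (hc : P.IsChoice c) (f : Fin n → ℕ) (i : Fin N) :
    ∑ x with P.grp x = i, (if P.assignment c x then f x else 0) = (c i).elim 0 f := by
  rw [← Finset.sum_filter, Finset.filter_filter]
  cases h : c i with
  | none =>
    refine Finset.sum_eq_zero fun x hx => ?_
    simp only [Finset.mem_filter, assignment_eq_true] at hx
    obtain ⟨-, rfl, hx⟩ := hx
    simp [h] at hx
  | some y =>
    have : (Finset.univ.filter fun x => P.grp x = i ∧ P.assignment c x = true) = {y} := by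
      ext x
      simp only [Finset.mem_filter, assignment_eq_true, Finset.mem_univ, true_and,
        Finset.mem_singleton]
      constructor
      · rintro ⟨rfl, hx⟩
        simpa [h, eq_comm] using hx
      · rintro rfl
        exact ⟨hc _ _ h, by rw [hc _ _ h, h]⟩
    rw [this]
    simp

theorem sum_assignment (hc : P.IsChoice c) (f : Fin n → ℕ) :
    ∑ x, (if P.assignment c x then f x else 0) = ∑ i, (c i).elim 0 f := by
  rw [← Finset.sum_fiberwise (s := Finset.univ) P.grp]
  exact Finset.sum_congr rfl fun i _ => sum_group_assignment hc f i

theorem pb_assignment (hc : P.IsChoice c) :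
    P.pb (P.assignment c) ↔ ∑ i, P.load c i ≤ P.K := by
  rw [pb, sum_assignment hc]
  rfl

theorem amos_assignment (hc : P.IsChoice c) : P.amos (P.assignment c) := by
  intro i
  rw [sum_group_assignment hc]
  cases c i <;> simp

theorem amos.eq_of_true {τ : Fin n → Bool} (h : P.amos τ) {x y : Fin n}
    (hxy : P.grp x = P.grp y) (hx : τ x = true) (hy : τ y = true) : x = y := by
  by_contra hne
  have h1 := h (P.grp x)
  rw [← Finset.sum_filter, Finset.sum_const, smul_eq_mul, mul_one, Finset.card_le_one] at h1
  exact hne (h1 x (by simp [hx]) y (by simp [hy, hxy]))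

theorem exists_choice (s : Set (Fin n))
    (h : ∀ x ∈ s, ∀ y ∈ s, P.grp x = P.grp y → x = y) :
    ∃ c, P.IsChoice c ∧ ∀ i x, c i = some x ↔ P.grp x = i ∧ x ∈ s := by
  classical
  refine ⟨fun i => if h : ∃ x ∈ s, P.grp x = i then some h.choose else none, ?_, ?_⟩
  · intro i x hx
    simp only at hx
    split_ifs at hx with hi
    obtain rfl : hi.choose = x := by simpa using hx
    exact hi.choose_spec.2
  · intro i x
    constructor
    · intro hx
      simp only at hx
      split_ifs at hx with hi
      obtain rfl : hi.choose = x := by simpa using hx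
      exact ⟨hi.choose_spec.2, hi.choose_spec.1⟩
    · rintro ⟨hi, hx⟩
      have hi' : ∃ x ∈ s, P.grp x = i := ⟨x, hx, hi⟩
      simp only [dif_pos hi', Option.some.injEq]
      exact h _ hi'.choose_spec.1 _ hx (hi'.choose_spec.2.trans hi.symm)

theorem amos.exists_choice {τ : Fin n → Bool} (h : P.amos τ) :
    ∃ c, P.IsChoice c ∧ τ = P.assignment c := by
  obtain ⟨c, hc, hcs⟩ := PBAMO.exists_choice (P := P) {x | τ x = true}
    fun x hx y hy hxy => h.eq_of_true hxy hx hy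
  refine ⟨c, hc, funext fun x => Bool.eq_iff_iff.2 ?_⟩
  rw [assignment_eq_true, hcs]
  simp

/-- The formula can be satisfied on the choices that satisfy the PB constraint. -/
def Sound (P : PBAMO n N) (F : CNF (Fin n ⊕ α)) : Prop :=
  ∀ c, P.IsChoice c → ∑ i, P.load c i ≤ P.K → ∃ σ, F.Sat (Sum.elim (P.assignment c) σ)

/-- Unit propagation detects the choices that violate the PB constraint. -/
def Detects (P : PBAMO n N) (F : CNF (Fin n ⊕ α)) : Prop :=
  ∀ c, P.IsChoice c → P.K < ∑ i, P.load c i → F.UPConflict (chosen c α)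

/-- If a choice that contains `x` violates the PB constraint, then unit propagation on the other
chosen variables refutes `x`. -/
def Refutes (P : PBAMO n N) (F : CNF (Fin n ⊕ α)) : Prop :=
  ∀ (A : Set (Literal (Fin n ⊕ α))) (g : Literal (Fin n ⊕ α)) (c : Fin N → Option (Fin n))
    (x : Fin n), P.IsChoice c → c (P.grp x) = some x → P.K < ∑ i, P.load c i →
    (∀ i y, c i = some y → F.Der A g (i = P.grp x) (Sum.inl y)) →
    F.UP A g.compl ∨ F.UPConflict A

theorem neg_notMem_chosen (w : Fin n ⊕ α) : neg w ∉ chosen c α := by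
  rintro ⟨i, x, -, h⟩
  exact Literal.pos_ne_neg _ _ h.symm

/-- Apply `Refutes` to any chosen `x`, with `x` itself among the assumptions: propagation then
derives the negation of an assumed literal. An overfull choice is nonempty, so such an `x` exists.
-/
theorem Refutes.detects {F : CNF (Fin n ⊕ α)} (h : P.Refutes F) : P.Detects F := by
  intro c hc hK
  obtain ⟨i, hi⟩ : ∃ i, P.load c i ≠ 0 := by
    by_contra! h0
    simp [h0] at hK
  obtain ⟨x, hx⟩ : ∃ x, c i = some x := by
    rw [← Option.ne_none_iff_exists']
    rintro h0
    simp [load, h0] at hi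
  have hup : ∀ i y, c i = some y → F.UP (chosen c α) (pos (Sum.inl y)) :=
    fun i y hy => .assumed _ ⟨i, y, hy, rfl⟩
  rcases h (chosen c α) (pos (Sum.inl x)) c x hc (by rw [hc _ _ hx, hx]) hK
    fun i y hy => .of_up (hup i y hy) with h | h
  · exact CNF.upConflict_of_up_compl (hup i x hx) h (neg_notMem_chosen _)
  · exact h

/-- This is the least extension: unassigned variables become false. It decides extendibility to the
PB constraint, as coefficients are nonnegative. -/
theorem exists_choice_of_extendible {A : PartialAssignment n} (hA : A.Extendible P.amos) :
    ∃ c, P.IsChoice c ∧ (∀ x, c (P.grp x) = some x ↔ A x = some true) ∧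
      A.ExtendedBy (P.assignment c) := by
  obtain ⟨τ, hτ, hM⟩ := hA
  obtain ⟨c, hc, hcs⟩ := exists_choice (P := P) {x | A x = some true}
    fun x hx y hy hxy => hM.eq_of_true hxy (hτ _ _ hx) (hτ _ _ hy)
  have hcs' : ∀ x, c (P.grp x) = some x ↔ A x = some true := fun x => by simp [hcs]
  refine ⟨c, hc, hcs', fun x b hb => ?_⟩
  cases b with
  | true => rw [assignment_eq_true, hcs', hb]
  | false => rw [← Bool.not_eq_true, assignment_eq_true, hcs', hb]; simp

theorem chosen_subset_lits {A : PartialAssignment n} (hc : P.IsChoice c)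
    (h : ∀ x, c (P.grp x) = some x ↔ A x = some true) : chosen c α ⊆ A.lits α := by
  rintro _ ⟨i, x, hx, rfl⟩
  exact ⟨x, true, by rw [← h, hc _ _ hx, hx], rfl⟩

theorem sat_chosen (hc : P.IsChoice c) (σ : α → Bool) :
    ∀ l ∈ chosen c α, Sum.elim (P.assignment c) σ l.var = l.sign := by
  rintro _ ⟨i, x, hx, rfl⟩
  simp [pos, assignment_eq_true, hc _ _ hx, hx]

/-! ### From properties of choices to encodings of the whole constraint. -/

variable {F : CNF (Fin n ⊕ α)} {H : CNF (Fin n ⊕ β)}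

theorem isEncoding_conj (hs : P.Sound F) (hd : P.Detects F) (hH : IsEncoding H P.amos) :
    IsEncoding (F.conj H) P.constraint := by
  intro τ
  simp only [CNF.sat_conj]
  constructor
  · rintro ⟨hp, hm⟩
    obtain ⟨ρ, hρ⟩ := (hH τ).1 hm
    obtain ⟨c, hc, rfl⟩ := hm.exists_choice
    obtain ⟨σ, hσ⟩ := hs c hc ((pb_assignment hc).1 hp)
    exact ⟨Sum.elim σ ρ, by simpa using ⟨hσ, hρ⟩⟩
  · rintro ⟨σ, hF, hσ⟩
    have hm := (hH τ).2 ⟨_, hσ⟩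
    refine ⟨?_, hm⟩
    obtain ⟨c, hc, rfl⟩ := hm.exists_choice
    rw [pb_assignment hc]
    -- A model of `F` cannot violate the PB constraint, since propagation, which is sound, would
    -- find a conflict on its true variables.
    by_contra! hK
    exact CNF.not_upConflict_of_sat hF (sat_chosen hc _) (hd c hc hK)

theorem isCC_conj (hd : P.Detects F) (hH : IsCC H P.amos) : IsCC (F.conj H) P.constraint := by
  intro A hA
  by_cases hM : A.Extendible P.amos
  · obtain ⟨c, hc, hcA, hext⟩ := exists_choice_of_extendible hM
    have hK : P.K < ∑ i, P.load c i := by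
      by_contra! hK
      exact hA ⟨_, hext, (pb_assignment hc).2 hK, amos_assignment hc⟩
    exact ((hd c hc hK).mono (List.Subset.refl _) (chosen_subset_lits hc hcA)).conj_left
  · exact (hH A hM).conj_right

theorem isCCEncoding_conj (hs : P.Sound F) (hd : P.Detects F) (hH : IsCCEncoding H P.amos) :
    IsCCEncoding (F.conj H) P.constraint :=
  ⟨isEncoding_conj hs hd hH.1, isCC_conj hd hH.2⟩

/-- The least extension of `A` is itself a model, so a forced unassigned variable is forced to
false. If its group is occupied, this is the work of `H`; otherwise adding the variable must
overfill the choice, and `Refutes` applies. -/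
theorem isGACEncoding_conj (hs : P.Sound F) (hr : P.Refutes F) (hH : IsGACEncoding H P.amos) :
    IsGACEncoding (F.conj H) P.constraint := by
  refine ⟨isEncoding_conj hs hr.detects hH.1, isCC_conj hr.detects hH.2.1, ?_⟩
  intro A hA x b hb
  have hM : A.Extendible P.amos := hA.imp fun τ h => ⟨h.1, h.2.2⟩
  obtain ⟨c, hc, hcA, hext⟩ := exists_choice_of_extendible hM
  have hsub : chosen c α ⊆ A.lits α := chosen_subset_lits hc hcA
  -- A model of the constraint extending `A` gives a model of `F` in which all of the chosen
  -- variables are true, so `Detects` rules out an overload.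
  have hK : ∑ i, P.load c i ≤ P.K := by
    by_contra! hK
    obtain ⟨τ, hτ, hpb, hm⟩ := hA
    obtain ⟨σ, hσ⟩ := (isEncoding_conj hs hr.detects hH.1 τ).1 ⟨hpb, hm⟩
    refine CNF.not_upConflict_of_sat ((CNF.sat_conj _ _ _ _).1 hσ).1 ?_ (hr.detects c hc hK)
    intro l hl
    obtain ⟨y, b, hy, rfl⟩ := hsub hl
    exact hτ _ _ hy
  have hbx := hb _ hext ⟨(pb_assignment hc).2 hK, amos_assignment hc⟩
  by_cases hAx : A x = none
  · obtain rfl : b = false := by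
      rw [← hbx, ← Bool.not_eq_true, assignment_eq_true, hcA, hAx]
      simp
    cases hg : c (P.grp x) with
    | some y =>
      refine CNF.UP.conj_right (hH.2.2 A hM x false fun τ hτ hm => ?_)
      rw [← Bool.not_eq_true]
      intro hx
      have hgy : P.grp y = P.grp x := hc _ _ hg
      have hy : A y = some true := by rw [← hcA, hgy, hg]
      have hyx := hm.eq_of_true hgy (hτ _ _ hy) hx
      rw [hyx, hAx] at hy
      cases hy
    | none =>
      have hc' : P.IsChoice (Function.update c (P.grp x) (some x)) := by
        intro i y hy
        by_cases hi : i = P.grp x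
        · subst hi
          rw [Function.update_self, Option.some.injEq] at hy
          rw [hy]
        · rw [Function.update_of_ne hi] at hy
          exact hc _ _ hy
      obtain ⟨σ, hσ⟩ := hs c hc hK
      -- Otherwise the enlarged choice would be a model extending `A` with `x` true, although `x` is
      -- forced to false.
      have hK' : P.K < ∑ i, P.load (Function.update c (P.grp x) (some x)) i := by
        by_contra! hK'
        have hτ : P.assignment (Function.update c (P.grp x) (some x)) x = false := by
          refine hb _ (fun y b hy => ?_) ⟨(pb_assignment hc').2 hK', amos_assignment hc'⟩
          rw [← hext y b hy]
          by_cases hyx : P.grp y = P.grp x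
          · have hne : x ≠ y := by
              rintro rfl
              simp [hAx] at hy
            simp [assignment, hyx, hg, hne]
          · simp [assignment, Function.update_of_ne hyx]
        simp [assignment] at hτ
      -- Only the old choice is assumed. The literal `g` is `x` itself, so `x` is trivially linked
      -- to `g`, and all other members are assumptions.
      have key := hr (chosen c α) (pos (Sum.inl x)) _ x hc' (by simp) hK' fun i y hy => by
        by_cases hi : i = P.grp x
        · subst hi
          rw [Function.update_self, Option.some.injEq] at hy
          subst hy
          exact .inr ⟨by simp, fun h => h⟩
        · rw [Function.update_of_ne hi] at hy
          exact .of_up (.assumed _ ⟨i, y, hy, rfl⟩)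
      rcases key with h | h
      · exact (h.mono (List.Subset.refl _) hsub).conj_left
      -- The old choice fits, so `Sound` gives a model that excludes a conflict.
      · exact absurd h (CNF.not_upConflict_of_sat hσ (sat_chosen hc σ))
  · obtain ⟨b', hb'⟩ := Option.ne_none_iff_exists'.1 hAx
    have : b = b' := hbx.symm.trans (hext x b' hb')
    exact .assumed _ ⟨x, b, this ▸ hb', rfl⟩

end PBAMO

/-! ### Partial sums of a choice -/

namespace PBAMO

variable {n N : ℕ} {P : PBAMO n N} {c : Fin N → Option (Fin n)}

/-- The sum of the coefficients chosen in the first `j` groups. -/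
def prefixLoad (P : PBAMO n N) (c : Fin N → Option (Fin n)) (j : ℕ) : ℕ :=
  ∑ i ∈ Finset.univ.filter (fun i : Fin N => (i : ℕ) < j), P.load c i

@[simp] theorem prefixLoad_zero : P.prefixLoad c 0 = 0 := by
  simp [prefixLoad]

theorem prefixLoad_succ {j : ℕ} (hj : j < N) :
    P.prefixLoad c (j + 1) = P.prefixLoad c j + P.load c ⟨j, hj⟩ := by
  have : (Finset.univ.filter fun i : Fin N => (i : ℕ) < j + 1) =
      insert ⟨j, hj⟩ (Finset.univ.filter fun i : Fin N => (i : ℕ) < j) := by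
    ext i
    simp only [Finset.mem_filter, Finset.mem_univ, true_and, Finset.mem_insert, Fin.ext_iff]
    omega
  rw [prefixLoad, this, Finset.sum_insert (by simp), add_comm]
  rfl

theorem prefixLoad_eq_sum : P.prefixLoad c N = ∑ i, P.load c i := by
  simp [prefixLoad]

theorem prefixLoad_mono {i j : ℕ} (h : i ≤ j) : P.prefixLoad c i ≤ P.prefixLoad c j :=
  Finset.sum_le_sum_of_subset fun a ha => by
    simp only [Finset.mem_filter, Finset.mem_univ, true_and] at ha ⊢
    omega

theorem prefixLoad_le_sum (j : ℕ) : P.prefixLoad c j ≤ ∑ i, P.load c i :=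
  Finset.sum_le_sum_of_subset (Finset.subset_univ _)

theorem load_of_assignment {x : Fin n} (h : P.assignment c x = true) :
    P.load c (P.grp x) = P.q x := by
  rw [assignment_eq_true] at h
  simp [load, h]

theorem load_of_eq_some {i : Fin N} {x : Fin n} (h : c i = some x) : P.load c i = P.q x := by
  simp [load, h]

theorem load_of_eq_none {i : Fin N} (h : c i = none) : P.load c i = 0 := by
  simp [load, h]

end PBAMO

/-! ### MDD -/

namespace MDD

variable {n : ℕ}

/-- The truth value of a diagram: a node holds iff its *else* child and its selected children do. -/
def eval (τ : Fin n → Bool) : MDD n → Bool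
  | bot => false
  | top => true
  | node _ els sel => eval τ els && decide (∀ x, τ x = true → eval τ (sel x) = true)

theorem sat_clauses (τ : Fin n → Bool) (v : MDD n) :
    CNF.Sat v.clauses (Sum.elim τ (eval τ)) := by
  induction v with
  | bot => simp [clauses, CNF.Sat]
  | top => simp [clauses, CNF.Sat]
  | node i els sel ih ihs =>
    rw [clauses, CNF.sat_append, CNF.sat_append]
    refine ⟨⟨?_, ih⟩, ?_⟩
    · intro c hc
      rcases List.mem_cons.1 hc with rfl | hc
      · by_cases h : eval τ els = true
        · exact ⟨_, List.mem_cons_self, h⟩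
        · exact ⟨_, List.mem_cons_of_mem _ List.mem_cons_self, by simp [neg, eval, h]⟩
      · obtain ⟨x, -, rfl⟩ := List.mem_map.1 hc
        by_cases h : eval τ (sel x) = true
        · exact ⟨_, List.mem_cons_self, h⟩
        · by_cases hx : τ x = true
          · refine ⟨neg (Sum.inr (node i els sel)), by simp, ?_⟩
            have : ¬ ∀ x, τ x = true → eval τ (sel x) = true := fun h' => h (h' x hx)
            simp only [neg, Sum.elim_inr, eval, this, decide_false, Bool.and_false]
          · exact ⟨neg (Sum.inl x), by simp, by simpa [neg] using hx⟩
    · intro c hc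
      obtain ⟨x, -, hc⟩ := List.mem_flatMap.1 hc
      exact ihs x c hc

theorem eval_mk {τ : Fin n → Bool} {i : ℕ} {els : MDD n} {sel : Fin n → MDD n}
    (h : eval τ els = true) (hs : ∀ x, τ x = true → eval τ (sel x) = true) :
    eval τ (mk i els sel) = true := by
  unfold mk
  split_ifs
  · exact h
  · simp only [eval, h, Bool.true_and, decide_eq_true_eq]
    exact hs

section

variable {F : CNF (Fin n ⊕ MDD n)} {A : Set (Literal (Fin n ⊕ MDD n))}
  {g : Literal (Fin n ⊕ MDD n)} {u v : Bool} {i : ℕ} {els : MDD n} {sel : Fin n → MDD n}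

/-- If `mk` drops the node because all children agree, the node is already its else-child and no
clause is needed. -/
theorem der_els (hF : (mk i els sel).clauses ⊆ F) (h : F.Der A g u (Sum.inr (mk i els sel))) :
    els.clauses ⊆ F ∧ F.Der A g u (Sum.inr els) := by
  unfold mk at hF h
  split_ifs at hF h
  · exact ⟨hF, h⟩
  · refine ⟨fun c hc => hF (by simp [clauses, hc]), ?_⟩
    exact h.imp (c := [pos (Sum.inr els), neg (Sum.inr (node i els sel))])
      (hF (by simp [clauses])) (by simp) (by simp) (by simp)

/-- A selected child equal to the else-child has no clause of its own; the clause for the else-child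
replaces it, without using `x`. -/
theorem der_sel {x : Fin n} (hF : (mk i els sel).clauses ⊆ F)
    (h : F.Der A g u (Sum.inr (mk i els sel))) (hx : F.Der A g v (Sum.inl x)) (huv : ¬ (u ∧ v)) :
    (sel x).clauses ⊆ F ∧ F.Der A g (u || v) (Sum.inr (sel x)) := by
  by_cases hxe : sel x = els
  · rw [hxe]
    exact (der_els hF h).imp_right fun h => h.weaken (by simp +contextual)
  · unfold mk at hF h
    have hne : ¬ ∀ x, sel x = els := fun h => hxe (h x)
    rw [if_neg hne] at hF h
    refine ⟨fun c hc => hF ?_, ?_⟩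
    · rw [clauses]
      exact List.mem_append_right _ (List.mem_flatMap.2 ⟨x, List.mem_finRange x, hc⟩)
    · refine h.imp₂ hx huv
        (c := [pos (Sum.inr (sel x)), neg (Sum.inl x), neg (Sum.inr (node i els sel))])
        (hF ?_) (by simp) (by simp) (by simp) (by simp)
      simp only [clauses, List.cons_append, List.mem_cons, List.mem_append, List.mem_map,
        List.mem_filter]
      exact .inr (.inl (.inl ⟨x, by simp [hxe], rfl⟩))

end

end MDD

namespace PBAMO

variable {n N : ℕ} {P : PBAMO n N} {c : Fin N → Option (Fin n)}

/-- The hypothesis says that `s` plus the load of the last `k` groups is at most `K`, written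
without subtraction. The else-child holds even when a variable is selected, because dropping a
variable only lowers the sum; hence the unconditional clauses to else-children are sound. -/
theorem eval_buildMDD {k s : ℕ} (hk : k ≤ N)
    (h : s + ∑ i, P.load c i ≤ P.K + P.prefixLoad c (N - k)) :
    (P.buildMDD k s).eval (P.assignment c) = true := by
  induction k generalizing s with
  | zero =>
    rw [Nat.sub_zero, prefixLoad_eq_sum] at h
    rw [buildMDD, if_pos (by omega)]
    rfl
  | succ k ih =>
    have hN : N - k = N - (k + 1) + 1 := by omega
    have hsucc := prefixLoad_succ (P := P) (c := c) (j := N - (k + 1)) (by omega)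
    rw [← hN] at hsucc
    rw [buildMDD]
    refine MDD.eval_mk (ih (by omega) (by omega)) fun x hx => ?_
    split_ifs with hg
    · refine ih (by omega) ?_
      have : P.load c ⟨N - (k + 1), by omega⟩ = P.q x := by
        rw [← load_of_assignment hx]
        congr
        exact hg.symm
      omega
    · exact ih (by omega) (by omega)

theorem mdd_sound : P.Sound P.mdd := by
  intro c hc hK
  refine ⟨MDD.eval (P.assignment c), (CNF.sat_append _ _ _).2 ⟨MDD.sat_clauses _ _, ?_⟩⟩
  have := eval_buildMDD (P := P) (c := c) (k := N) (s := 0) le_rfl (by omega)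
  simp [CNF.Sat, pos, neg, this, MDD.eval]

theorem mdd_refutes : P.Refutes P.mdd := by
  intro A g c x hc hx hK hder
  -- Follow the path of the choice through the diagram. The node reached depends on `g` only after
  -- the group of `x` has been read, so node and selector are never both linked.
  have key : ∀ j ≤ N, (P.buildMDD (N - j) (P.prefixLoad c j)).clauses ⊆ P.mdd ∧
      CNF.Der P.mdd A g ((P.grp x : ℕ) < j)
        (Sum.inr (P.buildMDD (N - j) (P.prefixLoad c j))) := by
    intro j hj
    induction j with
    | zero =>
      rw [prefixLoad_zero, Nat.sub_zero]
      refine ⟨List.subset_append_left _ _, .of_up (.propagated [pos (Sum.inr (P.buildMDD N 0))] _ ?_ (by simp) ?_)⟩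
      · simp [mdd]
      · simp
    | succ j ih =>
      obtain ⟨h1, h2⟩ := ih (by omega)
      have hN : N - j = N - (j + 1) + 1 := by omega
      rw [hN, buildMDD] at h1 h2
      have hNj : N - (N - (j + 1) + 1) = j := by omega
      rw [prefixLoad_succ (by omega)]
      cases hcj : c ⟨j, by omega⟩ with
      | none =>
        rw [load_of_eq_none hcj, add_zero]
        refine (MDD.der_els h1 h2).imp_right fun h => h.weaken ?_
        simp only [decide_eq_true_eq]
        omega
      | some y =>
        have hy := hc _ _ hcj
        have hd := hder _ _ hcj
        have := MDD.der_sel h1 h2 hd (by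
          simp only [decide_eq_true_eq, Fin.ext_iff]
          omega)
        rw [if_pos (by rw [hy, hNj])] at this
        rw [load_of_eq_some hcj]
        refine this.imp_right fun h => h.weaken ?_
        simp only [Bool.or_eq_true, decide_eq_true_eq, Fin.ext_iff]
        omega
  obtain ⟨-, h⟩ := key N le_rfl
  rw [Nat.sub_self, buildMDD, if_neg (by rw [prefixLoad_eq_sum]; omega)] at h
  exact h.refute (by simp [mdd])

/-! ### GSWC -/

theorem gswc_sound : P.Sound P.gswc := by
  intro c hc hK
  refine ⟨fun t => t.2 ≤ P.prefixLoad c t.1, ?_⟩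
  have hsucc : ∀ x, P.assignment c x = true →
      P.prefixLoad c (P.groupNo x) = P.prefixLoad c (P.groupNo x - 1) + P.q x := fun x hx => by
    rw [groupNo, prefixLoad_succ (P.grp x).2, Nat.add_sub_cancel]
    congr 1
    exact load_of_assignment hx
  rw [gswc, CNF.sat_append, CNF.sat_append, CNF.sat_append]
  refine ⟨⟨⟨?_, ?_⟩, ?_⟩, ?_⟩
  · intro cl hcl
    obtain ⟨i, -, hcl⟩ := List.mem_flatMap.1 hcl
    obtain ⟨j, -, rfl⟩ := List.mem_map.1 hcl
    have := prefixLoad_mono (P := P) (c := c) (Nat.sub_le i 1)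
    by_cases h : j ≤ P.prefixLoad c i
    · exact ⟨pos (Sum.inr (i, j)), by simp, by simpa [pos] using h⟩
    · exact ⟨_, List.mem_cons_self, by simp [neg]; omega⟩
  · intro cl hcl
    obtain ⟨x, -, hcl⟩ := List.mem_flatMap.1 hcl
    obtain ⟨j, hj, rfl⟩ := List.mem_map.1 hcl
    rw [List.mem_range'_1] at hj
    by_cases hx : P.assignment c x = true
    · have := hsucc x hx
      refine ⟨pos (Sum.inr (P.groupNo x, j)), by simp, ?_⟩
      simp only [pos, Sum.elim_inr, decide_eq_true_eq]
      omega
    · exact ⟨_, List.mem_cons_self, by simpa [neg] using hx⟩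
  · intro cl hcl
    obtain ⟨x, -, hcl⟩ := List.mem_flatMap.1 hcl
    obtain ⟨j, hj, rfl⟩ := List.mem_map.1 hcl
    rw [List.mem_range'_1] at hj
    by_cases hx : P.assignment c x = true
    · have := hsucc x hx
      by_cases h : j ≤ P.prefixLoad c (P.groupNo x - 1)
      · refine ⟨pos (Sum.inr (P.groupNo x, j + P.q x)), by simp, ?_⟩
        simp only [pos, Sum.elim_inr, decide_eq_true_eq]
        omega
      · exact ⟨_, List.mem_cons_self, by simpa [neg] using h⟩
    · exact ⟨neg (Sum.inl x), by simp, by simpa [neg] using hx⟩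
  · intro cl hcl
    obtain ⟨x, -, rfl⟩ := List.mem_map.1 hcl
    by_cases hx : P.assignment c x = true
    · have := hsucc x hx
      have := prefixLoad_le_sum (P := P) (c := c) (P.groupNo x)
      exact ⟨_, List.mem_cons_self, by simp [neg]; omega⟩
    · exact ⟨neg (Sum.inl x), by simp, by simpa [neg] using hx⟩

/-- Prefix sums are derived group by group until one would exceed `K`; there the overflow clause
applies and the first alternative of `key` holds from then on. There are no variables for the last
group, hence the guard `i < N`. -/
theorem gswc_refutes (hq : ∀ x, P.q x ≤ P.K) : P.Refutes P.gswc := by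
  intro A g c x hc hx hK hder
  have key : ∀ i ≤ N, (CNF.UP P.gswc A g.compl ∨ CNF.UPConflict P.gswc A) ∨
      (P.prefixLoad c i ≤ P.K ∧ (i < N → ∀ j, 1 ≤ j → j ≤ P.prefixLoad c i →
        CNF.Der P.gswc A g ((P.grp x : ℕ) < i) (Sum.inr (i, j)))) := by
    intro i hi
    induction i with
    | zero => exact .inr ⟨by simp, fun _ j h1 h2 => by simp at h2; omega⟩
    | succ i ih =>
      rcases ih (by omega) with h | ⟨hle, ih⟩
      · exact .inl h
      replace ih := ih (by omega)
      -- A positive prefix sum means that some group has been read, so the clauses referring to the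
      -- previous group exist.
      have hi0 : ∀ j, 1 ≤ j → j ≤ P.prefixLoad c i → 2 ≤ i + 1 := by
        intro j h1 h2
        rcases Nat.eq_zero_or_pos i with rfl | h
        · simp at h2; omega
        · omega
      rw [prefixLoad_succ (by omega)]
      cases hci : c ⟨i, by omega⟩ with
      | none =>
        rw [load_of_eq_none hci, add_zero]
        refine .inr ⟨hle, fun hiN j h1 h2 => ?_⟩
        refine ((ih j h1 h2).imp (c := [neg (Sum.inr (i, j)), pos (Sum.inr (i + 1, j))])
          ?_ (by simp) (by simp) (by simp)).weaken (by simp; omega)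
        simp only [gswc, List.mem_append, List.mem_flatMap, List.mem_filter, List.mem_range,
          List.mem_map, List.mem_range'_1, decide_eq_true_eq]
        refine .inl (.inl (.inl ⟨i + 1, ⟨hiN, hi0 j h1 h2⟩, j, ⟨h1, by omega⟩, rfl⟩))
      | some y =>
        have hy := hc _ _ hci
        have hd := hder _ _ hci
        have hgy : P.groupNo y = i + 1 := by rw [groupNo, hy]
        have hqy := hq y
        have hxor : ¬ (decide ((P.grp x : ℕ) < i) = true ∧
            decide ((⟨i, by omega⟩ : Fin N) = P.grp x) = true) := by
          simp only [decide_eq_true_eq, Fin.ext_iff]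
          omega
        rw [load_of_eq_some hci]
        by_cases hov : P.prefixLoad c i + P.q y ≤ P.K
        · refine .inr ⟨hov, fun hiN j h1 h2 => ?_⟩
          by_cases hj : j ≤ P.q y
          · refine (hd.imp (c := [neg (Sum.inl y), pos (Sum.inr (i + 1, j))])
              ?_ (by simp) (by simp) (by simp)).weaken (by simp [Fin.ext_iff]; omega)
            simp only [gswc, List.mem_append, List.mem_flatMap, List.mem_filter, List.mem_range,
              List.mem_map, List.mem_range'_1, decide_eq_true_eq]
            exact .inl (.inl (.inr ⟨y, ⟨List.mem_finRange _, by omega⟩, j, by omega, by rw [hgy]⟩))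
          · refine ((ih (j - P.q y) (by omega) (by omega)).imp₂ hd hxor
              (c := [neg (Sum.inr (i, j - P.q y)), neg (Sum.inl y), pos (Sum.inr (i + 1, j))])
              ?_ (by simp) (by simp) (by simp) (by simp)).weaken (by simp [Fin.ext_iff]; omega)
            have := hi0 (j - P.q y) (by omega) (by omega)
            simp only [gswc, List.mem_append, List.mem_flatMap, List.mem_filter, List.mem_range,
              List.mem_map, List.mem_range'_1, decide_eq_true_eq]
            refine .inl (.inr ⟨y, ⟨List.mem_finRange _, by omega⟩, j - P.q y, by omega, ?_⟩)
            rw [hgy, Nat.add_sub_cancel, Nat.sub_add_cancel (by omega)]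
        -- The index is positive because `P.q y ≤ P.K`, and it is at most the prefix sum because
        -- this group causes the overflow.
        · refine .inl ((ih (P.K + 1 - P.q y) (by omega) (by omega)).refute₂ hd hxor ?_)
          have := hi0 (P.K + 1 - P.q y) (by omega) (by omega)
          simp only [gswc, List.mem_append, List.mem_map, List.mem_filter, decide_eq_true_eq]
          refine .inr ⟨y, ⟨List.mem_finRange _, by omega⟩, ?_⟩
          rw [hgy, Nat.add_sub_cancel]
  rcases key N le_rfl with h | ⟨h, -⟩
  · exact h
  · rw [prefixLoad_eq_sum] at h
    omega

/-! ### GGT -/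

/-- The sum of the coefficients chosen in the groups at the leaves of a tree. -/
def treeLoad (P : PBAMO n N) (c : Fin N → Option (Fin n)) (t : BTree (Fin N)) : ℕ :=
  (t.leaves.map (P.load c)).sum

@[simp] theorem treeLoad_leaf (i : Fin N) : P.treeLoad c (.leaf i) = P.load c i := by
  simp [treeLoad, BTree.leaves]

@[simp] theorem treeLoad_node (l r : BTree (Fin N)) :
    P.treeLoad c (.node l r) = P.treeLoad c l + P.treeLoad c r := by
  simp [treeLoad, BTree.leaves]

theorem treeLoad_of_perm {t : BTree (Fin N)} (h : t.leaves.Perm (List.finRange N)) :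
    P.treeLoad c t = ∑ i, P.load c i := by
  rw [treeLoad, (h.map _).sum_eq, Fin.sum_univ_def]

theorem mem_group {i : Fin N} {x : Fin n} : x ∈ P.group i ↔ P.grp x = i := by
  simp [group]

theorem load_mem_vals_leaf (hc : P.IsChoice c) (i : Fin N) : P.load c i ∈ P.vals (.leaf i) := by
  rw [vals]
  cases h : c i with
  | none => simp [load, h]
  | some x =>
    exact Finset.mem_insert_of_mem (Finset.mem_image.2
      ⟨x, by simp [hc _ _ h], (load_of_eq_some h).symm⟩)

theorem min_treeLoad_mem_vals (hc : P.IsChoice c) (hq : ∀ x, P.q x ≤ P.K) (t : BTree (Fin N)) :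
    min (P.treeLoad c t) (P.K + 1) ∈ P.vals t := by
  induction t with
  | leaf i =>
    have hle : P.load c i ≤ P.K + 1 := by
      cases h : c i with
      | none => simp [load, h]
      | some x => rw [load_of_eq_some h]; exact (hq x).trans (Nat.le_succ _)
    rw [treeLoad_leaf, min_eq_left hle]
    exact load_mem_vals_leaf hc i
  | node l r hl hr =>
    rw [vals, treeLoad_node]
    refine Finset.mem_image₂.2 ⟨_, hl, _, hr, ?_⟩
    omega

theorem ggtVars_sound {t : BTree (Fin N)} {w : ℕ × (Fin n ⊕ (BTree (Fin N) × ℕ))}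
    (hw : w ∈ P.ggtVars t)
    (h : Sum.elim (P.assignment c) (fun v => decide (v.2 ≤ P.treeLoad c v.1)) w.2 = true) :
    w.1 ≤ P.treeLoad c t := by
  cases t with
  | leaf i =>
    obtain ⟨x, hx, rfl⟩ := List.mem_map.1 hw
    rw [← mem_group.1 hx, treeLoad_leaf, load_of_assignment h]
  | node l r =>
    obtain ⟨w, -, rfl⟩ := List.mem_map.1 hw
    simpa using h

/-- Reading `o_w` as "the load below is at least `w`" satisfies every clause; capping at `K + 1`
only weakens a conclusion. -/
theorem sat_ggtNode (l r : BTree (Fin N)) (keep : ℕ → Bool) :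
    (P.ggtNode l r keep).Sat
      (Sum.elim (P.assignment c) fun v => decide (v.2 ≤ P.treeLoad c v.1)) := by
  rw [ggtNode, CNF.sat_append]
  constructor
  · intro cl hcl
    obtain ⟨w, hw, rfl⟩ := List.mem_map.1 hcl
    rw [List.mem_filter, List.mem_append] at hw
    by_cases h : Sum.elim (P.assignment c) (fun v => decide (v.2 ≤ P.treeLoad c v.1)) w.2 = true
    · refine ⟨pos (Sum.inr (.node l r, w.1)), by simp, ?_⟩
      simp only [pos, Sum.elim_inr, decide_eq_true_eq, treeLoad_node]
      rcases hw.1 with hw | hw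
      · exact (ggtVars_sound hw h).trans (Nat.le_add_right _ _)
      · exact (ggtVars_sound hw h).trans (Nat.le_add_left _ _)
    · exact ⟨_, List.mem_cons_self, by simpa [neg] using h⟩
  · intro cl hcl
    obtain ⟨⟨v, w⟩, hw, rfl⟩ := List.mem_map.1 hcl
    rw [List.mem_filter, List.mem_product] at hw
    by_cases hv : Sum.elim (P.assignment c) (fun v => decide (v.2 ≤ P.treeLoad c v.1)) v.2 = true
    · by_cases h : Sum.elim (P.assignment c) (fun v => decide (v.2 ≤ P.treeLoad c v.1)) w.2 = true
      · refine ⟨pos (Sum.inr (.node l r, min (v.1 + w.1) (P.K + 1))), by simp, ?_⟩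
        simp only [pos, Sum.elim_inr, decide_eq_true_eq, treeLoad_node]
        have := ggtVars_sound hw.1.1 hv
        have := ggtVars_sound hw.1.2 h
        omega
      · exact ⟨neg w.2, by simp, by simpa [neg] using h⟩
    · exact ⟨neg v.2, by simp, by simpa [neg] using hv⟩

theorem sat_ggtClauses (t : BTree (Fin N)) :
    (P.ggtClauses t).Sat
      (Sum.elim (P.assignment c) fun v => decide (v.2 ≤ P.treeLoad c v.1)) := by
  induction t with
  | leaf i => simp [ggtClauses, CNF.Sat]
  | node l r hl hr =>
    rw [ggtClauses, CNF.sat_append, CNF.sat_append]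
    exact ⟨⟨sat_ggtNode l r _, hl⟩, hr⟩

theorem ggt_sound {t : BTree (Fin N)} (ht : t.leaves.Perm (List.finRange N)) :
    P.Sound (P.ggt t) := by
  intro c hc hK
  refine ⟨fun v => v.2 ≤ P.treeLoad c v.1, ?_⟩
  cases t with
  | leaf i => simp [ggt, CNF.Sat]
  | node l r =>
    rw [ggt, CNF.sat_append, CNF.sat_append, CNF.sat_append]
    refine ⟨⟨⟨sat_ggtNode l r _, sat_ggtClauses l⟩, sat_ggtClauses r⟩, ?_⟩
    rw [← treeLoad_of_perm ht] at hK
    simpa [CNF.Sat, neg, Nat.lt_succ_iff] using hK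

section

variable {F : CNF (Fin n ⊕ (BTree (Fin N) × ℕ))} {A : Set (Literal (Fin n ⊕ (BTree (Fin N) × ℕ)))}
  {g : Literal (Fin n ⊕ (BTree (Fin N) × ℕ))}

/-- The variable of value `w` of the node is derived. -/
def GGTDer (P : PBAMO n N) (F : CNF (Fin n ⊕ (BTree (Fin N) × ℕ)))
    (A : Set (Literal (Fin n ⊕ (BTree (Fin N) × ℕ)))) (g : Literal (Fin n ⊕ (BTree (Fin N) × ℕ)))
    (t : BTree (Fin N)) (b : Bool) (w : ℕ) : Prop :=
  w = 0 ∨ ∃ v, (w, v) ∈ P.ggtVars t ∧ F.Der A g b v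

/-- The value `0` has no variable, so a zero on one side calls for a one-premise clause and two
nonzero values for the two-premise one. The parameter `keep` covers inner nodes and the root
together. -/
theorem ggtNode_der {l r : BTree (Fin N)} {keep : ℕ → Bool} (hF : P.ggtNode l r keep ⊆ F)
    {u v : Bool} (huv : ¬ (u ∧ v)) {a b : ℕ} (ha : P.GGTDer F A g l u a)
    (hb : P.GGTDer F A g r v b) (haK : a ≤ P.K + 1) (hbK : b ≤ P.K + 1)
    (hk : keep (min (a + b) (P.K + 1)) = true) :
    min (a + b) (P.K + 1) = 0 ∨
      F.Der A g (u || v) (Sum.inr (.node l r, min (a + b) (P.K + 1))) := by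
  rcases ha with rfl | ⟨p, hp, ha⟩
  · rw [zero_add, min_eq_left hbK] at hk ⊢
    rcases hb with rfl | ⟨p, hp, hb⟩
    · exact .inl rfl
    · refine .inr ((hb.imp (c := [neg p, pos (Sum.inr (.node l r, b))]) (hF ?_)
        (by simp) (by simp) (by simp)).weaken (by simp +contextual))
      exact List.mem_append_left _ (List.mem_map.2 ⟨(b, p), by simp [hp, hk], rfl⟩)
  · rcases hb with rfl | ⟨q, hq, hb⟩
    · rw [add_zero, min_eq_left haK] at hk ⊢
      refine .inr ((ha.imp (c := [neg p, pos (Sum.inr (.node l r, a))]) (hF ?_)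
        (by simp) (by simp) (by simp)).weaken (by simp +contextual))
      exact List.mem_append_left _ (List.mem_map.2 ⟨(a, p), by simp [hp, hk], rfl⟩)
    · refine .inr (ha.imp₂ hb huv
        (c := [neg p, neg q, pos (Sum.inr (.node l r, min (a + b) (P.K + 1)))]) (hF ?_)
        (by simp) (by simp) (by simp) (by simp))
      refine List.mem_append_right _ (List.mem_map.2 ⟨((a, p), (b, q)), ?_, rfl⟩)
      rw [List.mem_filter, List.mem_product]
      exact ⟨⟨hp, hq⟩, hk⟩

/-- A node is linked to `g` exactly when the group of `x` lies below it. Since the leaves are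
distinct, this happens for at most one of two siblings. -/
theorem ggtClauses_der (hc : P.IsChoice c) (hq : ∀ x, P.q x ≤ P.K) {x : Fin n}
    (hder : ∀ i y, c i = some y → F.Der A g (i = P.grp x) (Sum.inl y)) {t : BTree (Fin N)}
    (ht : t.leaves.Nodup) (hF : P.ggtClauses t ⊆ F) :
    P.GGTDer F A g t (P.grp x ∈ t.leaves) (min (P.treeLoad c t) (P.K + 1)) := by
  induction t with
  | leaf i =>
    rw [treeLoad_leaf]
    cases h : c i with
    | none => exact .inl (by simp [load, h])
    | some y =>
      rw [load_of_eq_some h, min_eq_left ((hq y).trans (Nat.le_succ _))]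
      refine .inr ⟨Sum.inl y, List.mem_map.2 ⟨y, mem_group.2 (hc _ _ h), rfl⟩, ?_⟩
      exact (hder i y h).weaken (by simp [BTree.leaves, eq_comm])
  | node l r hl hr =>
    have hmem := min_treeLoad_mem_vals hc hq (.node l r)
    rw [BTree.leaves, List.nodup_append] at ht
    have hF1 : P.ggtNode l r (fun _ => true) ⊆ F := fun c hc => hF (by simp [ggtClauses, hc])
    have h := ggtNode_der hF1 (by
        simp only [decide_eq_true_eq]
        exact fun h => ht.2.2 _ h.1 _ h.2 rfl)
      (hl ht.1 fun c hc => hF (by simp [ggtClauses, hc]))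
      (hr ht.2.1 fun c hc => hF (by simp [ggtClauses, hc])) (by omega) (by omega) rfl
    have hmin : min (min (P.treeLoad c l) (P.K + 1) + min (P.treeLoad c r) (P.K + 1)) (P.K + 1) =
        min (P.treeLoad c (.node l r)) (P.K + 1) := by
      rw [treeLoad_node]
      omega
    rw [hmin] at h
    by_cases h0 : min (P.treeLoad c (.node l r)) (P.K + 1) = 0
    · exact .inl h0
    · refine .inr ⟨Sum.inr (.node l r, _), List.mem_map.2 ⟨_, ?_, rfl⟩,
        (h.resolve_left h0).weaken (by simp [BTree.leaves])⟩
      rw [Finset.mem_sort]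
      exact Finset.mem_erase.2 ⟨h0, hmem⟩

end

theorem ggt_refutes (hq : ∀ x, P.q x ≤ P.K) {t : BTree (Fin N)}
    (ht : t.leaves.Perm (List.finRange N)) : P.Refutes (P.ggt t) := by
  intro A g c x hc hx hK hder
  have hnd : t.leaves.Nodup := ht.nodup_iff.2 (List.nodup_finRange N)
  rw [← treeLoad_of_perm ht] at hK
  cases t with
  -- A single group cannot exceed `K`, so the tree without a root node never arises here.
  | leaf i =>
    rw [treeLoad_leaf] at hK
    cases h : c i with
    | none => simp [load, h] at hK
    | some y =>
      rw [load_of_eq_some h] at hK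
      exact absurd (hq y) (by omega)
  | node l r =>
    rw [BTree.leaves, List.nodup_append] at hnd
    rw [treeLoad_node] at hK
    have hmin : min (min (P.treeLoad c l) (P.K + 1) + min (P.treeLoad c r) (P.K + 1)) (P.K + 1) =
        P.K + 1 := by omega
    have h := ggtNode_der (F := P.ggt (.node l r)) (keep := fun w => w = P.K + 1)
      (fun c hc => by simp [ggt, hc]) (by
        simp only [decide_eq_true_eq]
        exact fun h => hnd.2.2 _ h.1 _ h.2 rfl)
      (ggtClauses_der hc hq hder hnd.1 fun c hc => by simp [ggt, hc])
      (ggtClauses_der hc hq hder hnd.2.1 fun c hc => by simp [ggt, hc]) (by omega) (by omega)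
      (by simp [hmin])
    rw [hmin] at h
    exact (h.resolve_left (by omega)).refute (by simp [ggt])

end PBAMO

/-! ### Lists of intervals -/

section mergeItvs

variable {same : WithTop ℕ → ℕ → Bool}

theorem exists_lo_of_mem_mergeItvs (L : List Itv) :
    ∀ J ∈ mergeItvs same L, ∃ I ∈ L, J.lo = I.lo := by
  induction L using mergeItvs.induct (same := same) with
  | case1 => simp [mergeItvs]
  | case2 I => simp [mergeItvs]
  | case3 I J L h ih =>
    rw [mergeItvs, if_pos h]
    intro K hK
    obtain ⟨I', hI', hK⟩ := ih K hK
    rcases List.mem_cons.1 hI' with rfl | hI'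
    · exact ⟨I, by simp, hK⟩
    · exact ⟨I', by simp [hI'], hK⟩
  | case4 I J L h ih =>
    rw [mergeItvs, if_neg h]
    intro K hK
    rcases List.mem_cons.1 hK with rfl | hK
    · exact ⟨_, List.mem_cons_self, rfl⟩
    · obtain ⟨I', hI', hK⟩ := ih K hK
      exact ⟨I', List.mem_cons_of_mem _ hI', hK⟩

theorem exists_hi_of_mem_mergeItvs (L : List Itv) :
    ∀ J ∈ mergeItvs same L, ∃ I ∈ L, J.hi = I.hi := by
  induction L using mergeItvs.induct (same := same) with
  | case1 => simp [mergeItvs]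
  | case2 I => simp [mergeItvs]
  | case3 I J L h ih =>
    rw [mergeItvs, if_pos h]
    intro K hK
    obtain ⟨I', hI', hK⟩ := ih K hK
    rcases List.mem_cons.1 hI' with rfl | hI'
    · exact ⟨J, by simp, hK⟩
    · exact ⟨I', by simp [hI'], hK⟩
  | case4 I J L h ih =>
    rw [mergeItvs, if_neg h]
    intro K hK
    rcases List.mem_cons.1 hK with rfl | hK
    · exact ⟨_, List.mem_cons_self, rfl⟩
    · obtain ⟨I', hI', hK⟩ := ih K hK
      exact ⟨I', List.mem_cons_of_mem _ hI', hK⟩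

/-- The intervals of the list are in ascending order, and disjoint. -/
def Ascending (L : List Itv) : Prop := L.Pairwise fun I J => I.hi < (J.lo : WithTop ℕ)

theorem Ascending.merge_head {I J : Itv} {L : List Itv} (h : Ascending (I :: J :: L)) :
    Ascending (⟨I.lo, J.hi⟩ :: L) :=
  List.pairwise_cons.2 ⟨(List.pairwise_cons.1 (List.pairwise_cons.1 h).2).1,
    (List.pairwise_cons.1 (List.pairwise_cons.1 h).2).2⟩

theorem Ascending.mergeItvs {L : List Itv} (hL : Ascending L) : Ascending (mergeItvs same L) := by
  induction L using mergeItvs.induct (same := same) with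
  | case1 => simpa [_root_.mergeItvs]
  | case2 I => simpa [_root_.mergeItvs]
  | case3 I J L h ih =>
    rw [_root_.mergeItvs, if_pos h]
    exact ih hL.merge_head
  | case4 I J L h ih =>
    rw [_root_.mergeItvs, if_neg h]
    have hL' := List.pairwise_cons.1 hL
    refine List.pairwise_cons.2 ⟨fun K hK => ?_, ih hL'.2⟩
    obtain ⟨I', hI', hK⟩ := exists_lo_of_mem_mergeItvs _ K hK
    rw [hK]
    exact hL'.1 I' hI'

/-- A merged interval is a chain of original ones, so a transitive relation that holds across each
of them and across each accepted gap holds between its ends. It is applied to indistinguishability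
by sibling values. -/
theorem Ascending.mergeItvs_rel {R : WithTop ℕ → WithTop ℕ → Prop}
    (htrans : ∀ a b c, R a b → R b c → R a c)
    (hsame : ∀ (b : WithTop ℕ) (c : ℕ), b < c → same b c = true → R b c)
    {L : List Itv} (hL : Ascending L) (h : ∀ I ∈ L, R I.lo I.hi) :
    ∀ I ∈ _root_.mergeItvs same L, R I.lo I.hi := by
  induction L using mergeItvs.induct (same := same) with
  | case1 => simp [_root_.mergeItvs]
  | case2 I => simpa [_root_.mergeItvs] using h
  | case3 I J L hIJ ih =>
    rw [_root_.mergeItvs, if_pos hIJ]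
    refine ih hL.merge_head fun K hK => ?_
    rcases List.mem_cons.1 hK with rfl | hK
    · have hlt := (List.pairwise_cons.1 hL).1 J List.mem_cons_self
      exact htrans _ _ _ (htrans _ _ _ (h I (by simp)) (hsame _ _ hlt hIJ)) (h J (by simp))
    · exact h K (by simp [hK])
  | case4 I J L hIJ ih =>
    rw [_root_.mergeItvs, if_neg hIJ]
    intro K hK
    rcases List.mem_cons.1 hK with rfl | hK
    · exact h _ List.mem_cons_self
    · exact ih (List.pairwise_cons.1 hL).2 (fun I hI => h I (List.mem_cons_of_mem _ hI)) K hK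

theorem Ascending.mergeItvs_cover {L : List Itv} (hL : Ascending L)
    (h : ∀ I ∈ L, (I.lo : WithTop ℕ) ≤ I.hi) :
    ∀ I ∈ L, ∃ J ∈ _root_.mergeItvs same L, J.lo ≤ I.lo ∧ I.hi ≤ J.hi := by
  induction L using mergeItvs.induct (same := same) with
  | case1 => simp
  | case2 I => simp [_root_.mergeItvs]
  | case3 I J L hIJ ih =>
    rw [_root_.mergeItvs, if_pos hIJ]
    have hlt := (List.pairwise_cons.1 hL).1 J List.mem_cons_self
    have hI := h I (by simp)
    have hJ := h J (by simp)
    have hlo : I.lo ≤ J.lo := by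
      have := hI.trans hlt.le
      exact_mod_cast this
    replace ih := ih hL.merge_head fun K hK => by
      rcases List.mem_cons.1 hK with rfl | hK
      · exact hI.trans (hlt.le.trans hJ)
      · exact h K (by simp [hK])
    obtain ⟨M, hM, hM1, hM2⟩ := ih _ List.mem_cons_self
    intro K hK
    rcases List.mem_cons.1 hK with rfl | hK
    · exact ⟨M, hM, hM1, (hlt.le.trans hJ).trans hM2⟩
    rcases List.mem_cons.1 hK with rfl | hK
    · exact ⟨M, hM, hM1.trans hlo, hM2⟩
    · exact ih K (List.mem_cons_of_mem _ hK)
  | case4 I J L hIJ ih =>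
    rw [_root_.mergeItvs, if_neg hIJ]
    intro K hK
    rcases List.mem_cons.1 hK with rfl | hK
    · exact ⟨_, List.mem_cons_self, le_rfl, le_rfl⟩
    · obtain ⟨M, hM, hM'⟩ := ih (List.pairwise_cons.1 hL).2
        (fun I hI => h I (List.mem_cons_of_mem _ hI)) K hK
      exact ⟨M, List.mem_cons_of_mem _ hM, hM'⟩

end mergeItvs

/-- `v` and `w` belong to the same interval. -/
def SameItv (U : List Itv) (v w : WithTop ℕ) : Prop := ∃ I ∈ U, Itv.Mem v I ∧ Itv.Mem w I

theorem Ascending.eq_of_mem {U : List Itv} (hU : Ascending U) {I J : Itv} (hI : I ∈ U) (hJ : J ∈ U)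
    {v : WithTop ℕ} (hvI : Itv.Mem v I) (hvJ : Itv.Mem v J) : I = J := by
  by_contra hne
  have : Std.Symm fun I J : Itv => I.hi < (J.lo : WithTop ℕ) ∨ J.hi < (I.lo : WithTop ℕ) :=
    ⟨fun _ _ h => h.symm⟩
  have hU' : U.Pairwise fun I J : Itv => I.hi < (J.lo : WithTop ℕ) ∨ J.hi < (I.lo : WithTop ℕ) :=
    List.Pairwise.imp Or.inl hU
  rcases hU'.forall hI hJ hne with h | h
  · exact absurd (hvJ.1.trans hvI.2) (not_le.2 h)
  · exact absurd (hvI.1.trans hvJ.2) (not_le.2 h)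

theorem Ascending.sameItv_trans {U : List Itv} (hU : Ascending U) {u v w : WithTop ℕ}
    (h : SameItv U u v) (h' : SameItv U v w) : SameItv U u w := by
  obtain ⟨I, hI, h1, h2⟩ := h
  obtain ⟨J, hJ, h3, h4⟩ := h'
  obtain rfl := hU.eq_of_mem hI hJ h2 h3
  exact ⟨I, hI, h1, h4⟩

theorem Ascending.mem_of_sameItv {U : List Itv} (hU : Ascending U) {u v : WithTop ℕ} {I : Itv}
    (hI : I ∈ U) (hu : Itv.Mem u I) (h : SameItv U u v) : Itv.Mem v I := by
  obtain ⟨J, hJ, h1, h2⟩ := h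
  rwa [hU.eq_of_mem hI hJ hu h1]

/-! ### The intervals at the nodes of an RGGT tree. -/

namespace PBAMO

variable {n N : ℕ} {P : PBAMO n N} {c : Fin N → Option (Fin n)}

/-- Disjoint intervals that cover the values in `S`, where `K + 1` stands for all the values over
`K`. -/
structure ItvCover (P : PBAMO n N) (S : Finset ℕ) (U : List Itv) : Prop where
  asc : Ascending U
  cover : ∀ v ∈ S, ∃ I ∈ U, Itv.Mem v I ∧ (v = P.K + 1 → I.hi = ⊤)

/-- Capping does not change the interval, because the interval containing `K + 1` is unbounded. -/
theorem ItvCover.mem_min_iff {S : Finset ℕ} {U : List Itv} (hU : P.ItvCover S U) {I : Itv}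
    (hI : I ∈ U) {v : ℕ} (hv : min v (P.K + 1) ∈ S) :
    Itv.Mem (min v (P.K + 1) : ℕ) I ↔ Itv.Mem v I := by
  rcases le_total v (P.K + 1) with h | h
  · rw [min_eq_left h]
  rw [min_eq_right h] at hv ⊢
  obtain ⟨J, hJ, hJ1, hJ2⟩ := hU.cover _ hv
  have hvJ : Itv.Mem (v : WithTop ℕ) J :=
    ⟨hJ1.1.trans (by exact_mod_cast h), by simp [hJ2 rfl]⟩
  constructor
  · intro h
    rwa [hU.asc.eq_of_mem hI hJ h hJ1]
  · intro h
    rwa [hU.asc.eq_of_mem hI hJ h hvJ]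

theorem vals_le (hq : ∀ x, P.q x ≤ P.K) (t : BTree (Fin N)) : ∀ v ∈ P.vals t, v ≤ P.K + 1 := by
  intro v hv
  cases t with
  | leaf i =>
    rw [vals, Finset.mem_insert, Finset.mem_image] at hv
    rcases hv with rfl | ⟨x, -, rfl⟩
    · exact Nat.zero_le _
    · exact (hq x).trans (Nat.le_succ _)
  | node l r =>
    obtain ⟨a, -, b, -, rfl⟩ := Finset.mem_image₂.1 hv
    exact min_le_right _ _

theorem sup_vals_le (hq : ∀ x, P.q x ≤ P.K) (t : BTree (Fin N)) :
    ((P.vals t).erase (P.K + 1)).sup id ≤ P.K := by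
  refine Finset.sup_le fun v hv => ?_
  have := vals_le hq t v (Finset.mem_of_mem_erase hv)
  have := Finset.ne_of_mem_erase hv
  simp only [id]
  omega

theorem zero_mem_vals (t : BTree (Fin N)) : 0 ∈ P.vals t := by
  induction t with
  | leaf i => simp [vals]
  | node l r hl hr => exact Finset.mem_image₂.2 ⟨0, hl, 0, hr, by simp⟩

theorem rootItvs_cover (hq : ∀ x, P.q x ≤ P.K) (t : BTree (Fin N)) :
    P.ItvCover (P.vals t) (P.rootItvs t) := by
  have hle := sup_vals_le hq t
  refine ⟨?_, fun v hv => ?_⟩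
  · simp only [Ascending, rootItvs, List.pairwise_cons, List.mem_singleton, forall_eq]
    refine ⟨?_, by simp⟩
    exact_mod_cast Nat.lt_succ_of_le hle
  · by_cases h : v = P.K + 1
    · exact ⟨⟨P.K + 1, ⊤⟩, by simp [rootItvs], by simp [Itv.Mem, h], fun _ => rfl⟩
    · refine ⟨⟨0, _⟩, List.mem_cons_self, ⟨by simp, ?_⟩, fun h' => absurd h' h⟩
      exact Nat.cast_le.2 (Finset.le_sup (f := id) (Finset.mem_erase.2 ⟨h, hv⟩))

theorem le_K_iff_of_sameItv_rootItvs (hq : ∀ x, P.q x ≤ P.K) {t : BTree (Fin N)} {a b : ℕ}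
    (h : SameItv (P.rootItvs t) a b) : a ≤ P.K ↔ b ≤ P.K := by
  have hle := sup_vals_le hq t
  obtain ⟨I, hI, ⟨ha, ha'⟩, hb, hb'⟩ := h
  simp only [rootItvs, List.mem_cons, List.not_mem_nil, or_false] at hI
  rcases hI with rfl | rfl
  · simp only [Nat.cast_le] at ha' hb'
    omega
  · simp only [Nat.cast_le] at ha hb
    omega

/-- The interval of a single value, where `K + 1` stands for all the values over `K`. -/
def pointItv (P : PBAMO n N) (a : ℕ) : Itv := ⟨a, if a < P.K + 1 then (a : WithTop ℕ) else ⊤⟩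

theorem pointItv_le (a : ℕ) : ((P.pointItv a).lo : WithTop ℕ) ≤ (P.pointItv a).hi := by
  unfold pointItv
  split_ifs <;> simp

/-- Only the value `K + 1` has an unbounded interval, and it is the largest. -/
theorem ascending_pointItvs (hq : ∀ x, P.q x ≤ P.K) (t : BTree (Fin N)) :
    Ascending ((P.vals t).sort.map P.pointItv) := by
  rw [Ascending, List.pairwise_map]
  refine ((P.vals t).sortedLT_sort.pairwise).imp_of_mem fun {a b} ha hb hab => ?_
  rw [Finset.mem_sort] at ha hb
  have := vals_le hq t b hb
  rw [pointItv, if_pos (by omega)]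
  simpa [pointItv] using hab

theorem childItvs_eq (U : List Itv) (v w : BTree (Fin N)) :
    P.childItvs U v w =
      mergeItvs (fun b c => ∀ a ∈ P.vals w, ∃ I ∈ U, Itv.Mem (a + b) I ∧ Itv.Mem (a + c : ℕ) I)
        ((P.vals v).sort.map P.pointItv) := rfl

theorem childItvs_cover (hq : ∀ x, P.q x ≤ P.K) (U : List Itv) (v w : BTree (Fin N)) :
    P.ItvCover (P.vals v) (P.childItvs U v w) := by
  rw [childItvs_eq]
  refine ⟨(ascending_pointItvs hq v).mergeItvs, fun a ha => ?_⟩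
  obtain ⟨J, hJ, h1, h2⟩ := (ascending_pointItvs hq v).mergeItvs_cover
    (by simpa using fun a _ => pointItv_le a) (P.pointItv a)
    (List.mem_map_of_mem ((Finset.mem_sort _).2 ha))
  refine ⟨J, hJ, ⟨by exact_mod_cast h1, (pointItv_le a).trans h2⟩, ?_⟩
  rintro rfl
  simpa [pointItv] using h2

theorem lo_mem_vals_of_mem_childItvs {U : List Itv} {v w : BTree (Fin N)} {I : Itv}
    (hI : I ∈ P.childItvs U v w) : I.lo ∈ P.vals v := by
  rw [childItvs_eq] at hI
  obtain ⟨J, hJ, h⟩ := exists_lo_of_mem_mergeItvs _ I hI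
  obtain ⟨a, ha, rfl⟩ := List.mem_map.1 hJ
  rw [h]
  exact (Finset.mem_sort _).1 ha

theorem hi_mem_vals_of_mem_childItvs {U : List Itv} {v w : BTree (Fin N)} {I : Itv}
    (hI : I ∈ P.childItvs U v w) : I.hi = ⊤ ∨ ∃ a ∈ P.vals v, I.hi = a := by
  rw [childItvs_eq] at hI
  obtain ⟨J, hJ, h⟩ := exists_hi_of_mem_mergeItvs _ I hI
  obtain ⟨a, ha, rfl⟩ := List.mem_map.1 hJ
  rw [h, pointItv]
  split_ifs
  · exact .inr ⟨a, (Finset.mem_sort _).1 ha, rfl⟩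
  · exact .inl rfl

/-- The merge test compares neighbouring values only. Membership in a common parent interval is
transitive since these intervals are disjoint, so the test carries over to the ends of a merged
interval. -/
theorem sameItv_lo_hi (hq : ∀ x, P.q x ≤ P.K) {S : Finset ℕ} {U : List Itv}
    (hU : P.ItvCover S U) {v w : BTree (Fin N)}
    (hS : ∀ a ∈ P.vals v, ∀ b ∈ P.vals w, min (b + a) (P.K + 1) ∈ S) {I : Itv}
    (hI : I ∈ P.childItvs U v w) {b : ℕ} (hb : b ∈ P.vals w) :
    SameItv U (b + I.lo) (b + I.hi) := by
  rw [childItvs_eq] at hI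
  refine (ascending_pointItvs hq v).mergeItvs_rel
    (R := fun x y => ∀ b ∈ P.vals w, SameItv U ((b : ℕ) + x) ((b : ℕ) + y)) ?_ ?_ ?_ I hI b hb
  · exact fun x y z h h' b hb => hU.asc.sameItv_trans (h b hb) (h' b hb)
  · intro x y _ h b hb
    simp only [decide_eq_true_eq] at h
    obtain ⟨I, hI, h⟩ := h b hb
    exact ⟨I, hI, h.1, by exact_mod_cast h.2⟩
  · intro J hJ b hb
    obtain ⟨a, ha, rfl⟩ := List.mem_map.1 hJ
    have ha := (Finset.mem_sort _).1 ha
    obtain ⟨I, hI, hI1, hI2⟩ := hU.cover _ (hS a ha b hb)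
    rw [hU.mem_min_iff hI (hS a ha b hb)] at hI1
    refine ⟨I, hI, by exact_mod_cast hI1, ?_⟩
    unfold pointItv
    split_ifs with haK
    · exact_mod_cast hI1
    -- For the value `K + 1` the upper end is infinite, and so is that of the parent interval
    -- containing the capped sum.
    · have := hI2 (by omega)
      exact ⟨by simp, by simp [this]⟩

theorem sameItv_add (hq : ∀ x, P.q x ≤ P.K) {S : Finset ℕ} {U : List Itv}
    (hU : P.ItvCover S U) {v w : BTree (Fin N)}
    (hS : ∀ a ∈ P.vals v, ∀ b ∈ P.vals w, min (b + a) (P.K + 1) ∈ S) {x y : WithTop ℕ}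
    (h : SameItv (P.childItvs U v w) x y) {b : ℕ} (hb : b ∈ P.vals w) :
    SameItv U (b + x) (b + y) := by
  obtain ⟨I, hI, hx, hy⟩ := h
  obtain ⟨J, hJ, h1, h2⟩ := sameItv_lo_hi hq hU hS hI hb
  exact ⟨J, hJ, ⟨h1.1.trans (by gcongr; exact hx.1), le_trans (by gcongr; exact hx.2) h2.2⟩,
    h1.1.trans (by gcongr; exact hy.1), le_trans (by gcongr; exact hy.2) h2.2⟩

theorem min_add_mem_vals (l r : BTree (Fin N)) :
    ∀ a ∈ P.vals l, ∀ b ∈ P.vals r, min (b + a) (P.K + 1) ∈ P.vals (.node l r) :=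
  fun a ha b hb => Finset.mem_image₂.2 ⟨a, ha, b, hb, by rw [add_comm]⟩

theorem min_add_mem_vals' (l r : BTree (Fin N)) :
    ∀ a ∈ P.vals r, ∀ b ∈ P.vals l, min (b + a) (P.K + 1) ∈ P.vals (.node l r) :=
  fun a ha b hb => Finset.mem_image₂.2 ⟨b, hb, a, ha, rfl⟩

/-- Two values of each child that belong to the same intervals have sums that belong to the same
interval. -/
theorem sameItv_add_add (hq : ∀ x, P.q x ≤ P.K) {l r : BTree (Fin N)} {U : List Itv}
    (hU : P.ItvCover (P.vals (.node l r)) U) {x : WithTop ℕ} {a b : ℕ} {y : WithTop ℕ}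
    (hb : b ∈ P.vals r) (hx : x = ⊤ ∨ ∃ v ∈ P.vals l, x = v)
    (h : SameItv (P.childItvs U l r) a x) (h' : SameItv (P.childItvs U r l) b y) :
    SameItv U (a + b) (x + y) := by
  -- The summands are changed one at a time. Changing the second requires the new first summand to
  -- be a value of `l`, since the merge test covers only sibling values; an infinite first summand
  -- absorbs the second.
  have h1 := sameItv_add hq hU (min_add_mem_vals l r) h hb
  rcases hx with rfl | ⟨v, hv, rfl⟩
  · simpa [add_comm] using h1
  · have h2 := sameItv_add hq hU (min_add_mem_vals' l r) h' hv
    rw [add_comm (b : WithTop ℕ), add_comm (b : WithTop ℕ)] at h1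
    exact hU.asc.sameItv_trans h1 h2

/-! ### The reduction of RGGT -/

/-- The alternative `I.lo = P.K + 1` occurs only when the root is a leaf, and such an interval never
lowers a coefficient at most `K`. -/
theorem newCoeff_leaf (x : Fin n) {U : List Itv} {i : Fin N} (hU : P.ItvCover (P.vals (.leaf i)) U)
    (hlo : ∀ I ∈ U, I.lo ∈ P.vals (.leaf i) ∨ I.lo = P.K + 1) (hq : P.q x ≤ P.K)
    (hx : P.grp x = i) :
    SameItv U (P.q x) (P.newCoeff x U (.leaf i)) ∧ P.newCoeff x U (.leaf i) ∈ P.vals (.leaf i) := by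
  have hqx : P.q x ∈ P.vals (.leaf i) := by
    rw [vals]
    exact Finset.mem_insert_of_mem (Finset.mem_image.2 ⟨x, by simp [hx], rfl⟩)
  rw [newCoeff, if_pos hx]
  split
  · rename_i I hI
    have h1 := List.find?_some hI
    have h2 := List.mem_of_find?_eq_some hI
    simp only [decide_eq_true_eq] at h1
    have h3 : (I.lo : WithTop ℕ) ≤ P.q x := by exact_mod_cast h1.1.le
    exact ⟨⟨I, h2, ⟨h3, h1.2⟩, le_rfl, h3.trans h1.2⟩, (hlo I h2).resolve_right (by omega)⟩
  · obtain ⟨I, hI, h, -⟩ := hU.cover _ hqx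
    exact ⟨⟨I, hI, h, h⟩, hqx⟩

/-- A coefficient strictly above the lower end of its interval would still be reduced. At the fixed
point, the terms in an interval are therefore those that `termsWith` finds at its lower end. -/
theorem lo_eq_of_newCoeff_eq {x : Fin n} {U : List Itv} (h : P.newCoeff x U (.leaf (P.grp x)) = P.q x)
    {I : Itv} (hI : I ∈ U) (hm : Itv.Mem (P.q x) I) : I.lo = P.q x := by
  rw [newCoeff, if_pos rfl] at h
  have hle : I.lo ≤ P.q x := by exact_mod_cast hm.1
  split at h
  · rename_i J hJ
    have h1 := List.find?_some hJ
    simp only [decide_eq_true_eq] at h1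
    omega
  · rename_i hnone
    have := List.find?_eq_none.1 hnone I hI
    simp only [decide_eq_true_eq, not_and] at this
    by_contra hne
    exact this (by omega) hm.2

/-- At every node the old and new loads share an interval, by `sameItv_add_add` from the children.
The function `q'` is fixed for the whole tree, while the intervals vary with the subtree. -/
theorem sameItv_newCoeff (hc : P.IsChoice c) (hq : ∀ x, P.q x ≤ P.K) {q' : Fin n → ℕ}
    {t : BTree (Fin N)} {U : List Itv} (hU : P.ItvCover (P.vals t) U)
    (hlo : ∀ I ∈ U, I.lo ∈ P.vals t ∨ I.lo = P.K + 1) (ht : t.leaves.Nodup)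
    (hq' : ∀ x, P.grp x ∈ t.leaves → q' x = P.newCoeff x U t) :
    SameItv U (min (P.treeLoad c t) (P.K + 1) : ℕ)
        (min ((P.withCoeffs q').treeLoad c t) (P.K + 1) : ℕ) ∧
      min ((P.withCoeffs q').treeLoad c t) (P.K + 1) ∈ P.vals t := by
  induction t generalizing U with
  | leaf i =>
    rw [treeLoad_leaf, treeLoad_leaf]
    cases h : c i with
    | none =>
      obtain ⟨I, hI, h0, -⟩ := hU.cover 0 (zero_mem_vals _)
      rw [load_of_eq_none h, load_of_eq_none h]
      exact ⟨⟨I, hI, by simpa using h0, by simpa using h0⟩, by simpa using zero_mem_vals _⟩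
    | some y =>
      have hy := hc _ _ h
      have key := newCoeff_leaf y hU hlo (hq y) hy
      rw [← hq' y (by simp [BTree.leaves, hy])] at key
      have hle : q' y ≤ P.q y := by
        rw [hq' y (by simp [BTree.leaves, hy])]
        exact newCoeff_le _ _ _ _
      have hqy := hq y
      rw [load_of_eq_some h, load_of_eq_some h, min_eq_left (by omega)]
      change SameItv U _ (min (q' y) (P.K + 1) : ℕ) ∧ min (q' y) (P.K + 1) ∈ _
      rwa [min_eq_left (by omega)]
  | node l r hl hr =>
    rw [BTree.leaves, List.nodup_append] at ht
    obtain ⟨l1, l2⟩ := hl (childItvs_cover hq U l r)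
      (fun I hI => .inl (lo_mem_vals_of_mem_childItvs hI)) ht.1 fun x hx => by
        rw [hq' x (by simp [BTree.leaves, hx]), newCoeff, if_pos hx]
    obtain ⟨r1, r2⟩ := hr (childItvs_cover hq U r l)
      (fun I hI => .inl (lo_mem_vals_of_mem_childItvs hI)) ht.2.1 fun x hx => by
        rw [hq' x (by simp [BTree.leaves, hx]), newCoeff,
          if_neg fun hx' => ht.2.2 _ hx' _ hx rfl]
    have hmin : ∀ a b : ℕ, min (min a (P.K + 1) + min b (P.K + 1)) (P.K + 1) =
        min (a + b) (P.K + 1) := by omega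
    obtain ⟨I, hI, h1, h2⟩ := sameItv_add_add hq hU (min_treeLoad_mem_vals hc hq r)
      (.inr ⟨_, l2, rfl⟩) l1 r1
    have hm := min_add_mem_vals' l r _ (min_treeLoad_mem_vals hc hq r) _
      (min_treeLoad_mem_vals hc hq l)
    have hm' := min_add_mem_vals' l r _ r2 _ l2
    rw [treeLoad_node, treeLoad_node, ← hmin, ← hmin ((P.withCoeffs q').treeLoad c l)]
    refine ⟨⟨I, hI, (hU.mem_min_iff hI hm).2 (by exact_mod_cast h1),
      (hU.mem_min_iff hI hm').2 (by exact_mod_cast h2)⟩, hm'⟩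

theorem load_eq_zero_of_notMem_liveGroups (hc : P.IsChoice c) {i : Fin N}
    (hi : i ∉ P.liveGroups) : P.load c i = 0 := by
  cases h : c i with
  | none => exact load_of_eq_none h
  | some x =>
    rw [load_of_eq_some h]
    by_contra h0
    refine hi ?_
    rw [liveGroups, List.mem_filter]
    exact ⟨List.mem_finRange i, by simpa using ⟨x, hc _ _ h, Nat.pos_of_ne_zero h0⟩⟩

theorem nodup_liveGroups : P.liveGroups.Nodup := (List.nodup_finRange N).filter _

theorem treeLoad_of_perm_live {t : BTree (Fin N)} (ht : t.leaves.Perm P.liveGroups)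
    {Q : PBAMO n N} (h : ∀ i ∉ P.liveGroups, Q.load c i = 0) :
    Q.treeLoad c t = ∑ i, Q.load c i := by
  rw [treeLoad, (ht.map _).sum_eq, ← List.sum_toFinset _ nodup_liveGroups]
  exact Finset.sum_subset (Finset.subset_univ _) fun i _ hi => h i (by simpa using hi)

/-- At the root, sharing an interval means being on the same side of `K`. Deleted groups have load
zero before and after the pass. -/
theorem sum_load_rggtPass_le_iff (hc : P.IsChoice c) (hq : ∀ x, P.q x ≤ P.K) {t : BTree (Fin N)}
    (ht : t.leaves.Perm P.liveGroups) :
    ∑ i, (P.rggtPass t).load c i ≤ P.K ↔ ∑ i, P.load c i ≤ P.K := by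
  rw [← treeLoad_of_perm_live ht fun i hi => load_eq_zero_of_notMem_liveGroups hc hi,
    ← treeLoad_of_perm_live ht (Q := P.rggtPass t) fun i hi => ?_]
  · have := (sameItv_newCoeff hc hq (q' := fun x => P.newCoeff x (P.rootItvs t) t)
      (rootItvs_cover hq t) (by
        intro I hI
        simp only [rootItvs, List.mem_cons, List.not_mem_nil, or_false] at hI
        rcases hI with rfl | rfl
        · exact .inl (zero_mem_vals _)
        · exact .inr rfl)
      (ht.nodup_iff.2 nodup_liveGroups) fun x _ => rfl).1
    have := le_K_iff_of_sameItv_rootItvs hq this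
    change (P.rggtPass t).treeLoad c t ≤ P.K ↔ _
    have hrw : (P.withCoeffs fun x => P.newCoeff x (P.rootItvs t) t) = P.rggtPass t := rfl
    rw [hrw] at this
    omega
  · have h0 := load_eq_zero_of_notMem_liveGroups hc hi
    cases h : c i with
    | none => exact load_of_eq_none h
    | some x =>
      rw [load_of_eq_some h] at h0 ⊢
      exact Nat.le_zero.1 (h0 ▸ newCoeff_le P x _ _)

/-- An overfull choice stays overfull after a pass, so some group always survives and `build`
returns a proper tree. -/
theorem rggtReduce_spec {build : PBAMO n N → BTree (Fin N)}
    (hb : ∀ Q : PBAMO n N, Q.liveGroups ≠ [] → (build Q).leaves.Perm Q.liveGroups)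
    (P : PBAMO n N) (hq : ∀ x, P.q x ≤ P.K)
    (hov : ∃ c, P.IsChoice c ∧ P.K < ∑ i, P.load c i) :
    (rggtReduce build P).grp = P.grp ∧ (rggtReduce build P).K = P.K ∧
      (∀ x, (rggtReduce build P).q x ≤ P.q x) ∧
      (∀ c, P.IsChoice c →
        (∑ i, (rggtReduce build P).load c i ≤ P.K ↔ ∑ i, P.load c i ≤ P.K)) ∧
      (build (rggtReduce build P)).leaves.Perm (rggtReduce build P).liveGroups ∧
      ((rggtReduce build P).rggtPass (build (rggtReduce build P))).q =
        (rggtReduce build P).q := by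
  have hlive : ∀ P : PBAMO n N, (∃ c, P.IsChoice c ∧ P.K < ∑ i, P.load c i) →
      P.liveGroups ≠ [] := by
    rintro P ⟨c, hc, hK⟩ h
    have : ∀ i, P.load c i = 0 := fun i =>
      load_eq_zero_of_notMem_liveGroups hc (by simp [h])
    simp [this] at hK
  induction P using rggtReduce.induct (build := build) with
  | case1 P h =>
    rw [rggtReduce, if_pos h]
    exact ⟨rfl, rfl, fun x => le_rfl, fun c _ => Iff.rfl, hb P (hlive P hov), h⟩
  | case2 P h ih =>
    have hp := hb P (hlive P hov)
    rw [rggtReduce, if_neg h]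
    have hle : ∀ x, (P.rggtPass (build P)).q x ≤ P.q x := fun x => newCoeff_le P x _ _
    obtain ⟨h1, h2, h3, h4, h5⟩ := ih (fun x => (hle x).trans (hq x)) (by
      obtain ⟨c, hc, hK⟩ := hov
      refine ⟨c, hc, ?_⟩
      rw [← not_le] at hK ⊢
      rwa [show (P.rggtPass (build P)).K = P.K from rfl, sum_load_rggtPass_le_iff hc hq hp])
    exact ⟨h1, h2, fun x => (h3 x).trans (hle x),
      fun c hc => (h4 c hc).trans (sum_load_rggtPass_le_iff hc hq hp), h5⟩

end PBAMO

namespace PBAMO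

variable {n N : ℕ} {P : PBAMO n N} {c : Fin N → Option (Fin n)}

/-! ### RGGT -/

theorem mem_termsWith {i : Fin N} {a : ℕ} {x : Fin n} :
    x ∈ P.termsWith i a ↔ P.grp x = i ∧ P.q x = a := by
  simp [termsWith, mem_group]

/-- The assignment of the auxiliary variables of RGGT that belongs to a choice. -/
def rggtModel (P : PBAMO n N) (c : Fin N → Option (Fin n)) :
    Fin n ⊕ (BTree (Fin N) × Itv) → Bool :=
  Sum.elim (P.assignment c) fun v => decide (v.2.lo ≤ P.treeLoad c v.1)

theorem rggtVars_sound {U : List Itv} {t : BTree (Fin N)}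
    {w : Itv × (Fin n ⊕ (BTree (Fin N) × Itv))} (hw : w ∈ P.rggtVars U t)
    (h : P.rggtModel c w.2 = true) : w.1.lo ≤ P.treeLoad c t := by
  cases t with
  | leaf i =>
    obtain ⟨I, -, rfl⟩ := List.mem_map.1 hw
    split at h
    · rename_i x hx
      have hx : x ∈ P.termsWith i I.lo := by simp [hx]
      rw [mem_termsWith] at hx
      rw [treeLoad_leaf, ← hx.1, load_of_assignment h, hx.2]
    · simpa [rggtModel] using h
  | node l r =>
    obtain ⟨I, -, rfl⟩ := List.mem_map.1 hw
    simpa [rggtModel] using h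

theorem rggtVars_node {U : List Itv} {l r : BTree (Fin N)}
    {w : Itv × (Fin n ⊕ (BTree (Fin N) × Itv))} (hw : w ∈ P.rggtVars U (.node l r)) :
    w.2 = Sum.inr (.node l r, w.1) := by
  obtain ⟨I, -, rfl⟩ := List.mem_map.1 hw
  rfl

/-- Only the lower ends of the intervals matter for soundness. -/
theorem sat_rggtClauses (U : List Itv) (t : BTree (Fin N)) :
    (P.rggtClauses U t).Sat (P.rggtModel c) := by
  induction t generalizing U with
  | leaf i =>
    intro cl hcl
    obtain ⟨I, -, hcl⟩ := List.mem_flatMap.1 hcl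
    split at hcl
    · cases hcl
    · obtain ⟨x, hx, rfl⟩ := List.mem_map.1 hcl
      rw [mem_termsWith] at hx
      by_cases h : P.assignment c x = true
      · refine ⟨pos (Sum.inr (.leaf i, I)), by simp, ?_⟩
        simp [pos, rggtModel, ← hx.1, load_of_assignment h, hx.2]
      · exact ⟨_, List.mem_cons_self, by simpa [neg, rggtModel] using h⟩
  | node l r hl hr =>
    rw [rggtClauses, CNF.sat_append, CNF.sat_append, CNF.sat_append]
    refine ⟨⟨⟨?_, ?_⟩, hl _⟩, hr _⟩
    · intro cl hcl
      obtain ⟨⟨v, o⟩, hv, rfl⟩ := List.mem_map.1 hcl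
      rw [List.mem_filter, List.mem_product, List.mem_append] at hv
      simp only [decide_eq_true_eq] at hv
      obtain ⟨⟨hv, ho⟩, hlo, -⟩ := hv
      by_cases h : P.rggtModel c v.2 = true
      · refine ⟨pos o.2, by simp, ?_⟩
        rw [rggtVars_node ho]
        simp only [pos, rggtModel, Sum.elim_inr, decide_eq_true_eq, treeLoad_node]
        rcases hv with hv | hv
        · have := rggtVars_sound hv h
          omega
        · have := rggtVars_sound hv h
          omega
      · exact ⟨_, List.mem_cons_self, by simpa [neg] using h⟩
    · intro cl hcl
      obtain ⟨⟨⟨v, w⟩, o⟩, hv, rfl⟩ := List.mem_map.1 hcl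
      rw [List.mem_filter, List.mem_product, List.mem_product] at hv
      simp only [decide_eq_true_eq] at hv
      obtain ⟨⟨⟨hv, hw⟩, ho⟩, hlo, -⟩ := hv
      by_cases h : P.rggtModel c v.2 = true
      · by_cases h' : P.rggtModel c w.2 = true
        · refine ⟨pos o.2, by simp, ?_⟩
          rw [rggtVars_node ho]
          simp only [pos, rggtModel, Sum.elim_inr, decide_eq_true_eq, treeLoad_node]
          have := rggtVars_sound hv h
          have := rggtVars_sound hw h'
          omega
        · exact ⟨neg w.2, by simp, by simpa [neg] using h'⟩
      · exact ⟨neg v.2, by simp, by simpa [neg] using h⟩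

section

variable {F : CNF (Fin n ⊕ (BTree (Fin N) × Itv))}
  {A : Set (Literal (Fin n ⊕ (BTree (Fin N) × Itv)))} {g : Literal (Fin n ⊕ (BTree (Fin N) × Itv))}

/-- The variable of the interval of `s` is derived. -/
def RGGTDer (P : PBAMO n N) (F : CNF (Fin n ⊕ (BTree (Fin N) × Itv)))
    (A : Set (Literal (Fin n ⊕ (BTree (Fin N) × Itv)))) (g : Literal (Fin n ⊕ (BTree (Fin N) × Itv)))
    (U : List Itv) (t : BTree (Fin N)) (b : Bool) (s : ℕ) : Prop :=
  ∃ I ∈ U, Itv.Mem s I ∧ (I.lo = 0 ∨ ∃ v, (I, v) ∈ P.rggtVars U t ∧ F.Der A g b v)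

theorem rggtDer_leaf (hc : P.IsChoice c) {x : Fin n}
    (hder : ∀ i y, c i = some y → F.Der A g (i = P.grp x) (Sum.inl y)) {i : Fin N} {U : List Itv}
    (hU : P.ItvCover (P.vals (.leaf i)) U)
    (hfix : ∀ y, P.grp y = i → P.newCoeff y U (.leaf i) = P.q y)
    (hF : P.rggtClauses U (.leaf i) ⊆ F) :
    P.RGGTDer F A g U (.leaf i) (P.grp x = i) (P.load c i) := by
  obtain ⟨I, hI, hm, -⟩ := hU.cover _ (load_mem_vals_leaf hc i)
  refine ⟨I, hI, hm, ?_⟩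
  cases h : c i with
  | none =>
    rw [load_of_eq_none h] at hm
    have : I.lo ≤ 0 := by exact_mod_cast hm.1
    exact .inl (by omega)
  | some y =>
    rw [load_of_eq_some h] at hm
    obtain rfl := hc _ _ h
    have hlo := lo_eq_of_newCoeff_eq (hfix y rfl) hI hm
    -- The reduction may have lowered the coefficient of `y` to `0`; such a term counts as deleted
    -- and needs no variable.
    by_cases h0 : I.lo = 0
    · exact .inl h0
    right
    have hy : y ∈ P.termsWith (P.grp y) I.lo := mem_termsWith.2 ⟨rfl, hlo.symm⟩
    have hd := (hder _ _ h).weaken (v := decide (P.grp x = P.grp y)) (by simp [eq_comm])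
    have hIf : I ∈ U.filter fun I => 0 < I.lo := by
      simp [hI, Nat.pos_of_ne_zero h0]
    by_cases hs : ∃ z, P.termsWith (P.grp y) I.lo = [z]
    · obtain ⟨z, hz⟩ := hs
      obtain rfl : y = z := by simpa [hz] using hy
      exact ⟨Sum.inl y, List.mem_map.2 ⟨I, hIf, by simp [hz]⟩, hd⟩
    · push Not at hs
      refine ⟨Sum.inr (.leaf (P.grp y), I), List.mem_map.2 ⟨I, hIf, ?_⟩, ?_⟩
      · split
        · rename_i hz
          exact absurd hz (hs _)
        · rfl
      · refine hd.imp (c := [neg (Sum.inl y), pos (Sum.inr (.leaf (P.grp y), I))]) (hF ?_)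
          (by simp) (by simp) (by simp)
        refine List.mem_flatMap.2 ⟨I, hIf, ?_⟩
        split
        · rename_i hz
          exact absurd hz (hs _)
        · exact List.mem_map.2 ⟨y, hy, rfl⟩

/-- The parent interval `O` of the capped sum also contains the sums of the lower and of the upper
ends of the child intervals, so the containment conditions of the required clause are met. If both
lower ends are `0`, so is that of `O`. -/
theorem rggtDer_node (hq : ∀ x, P.q x ≤ P.K) {l r : BTree (Fin N)} {U : List Itv}
    (hU : P.ItvCover (P.vals (.node l r)) U) (hF : P.rggtClauses U (.node l r) ⊆ F) {u v : Bool}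
    (huv : ¬ (u ∧ v)) {a b : ℕ} (ha : a ∈ P.vals l) (hb : b ∈ P.vals r)
    (hl : P.RGGTDer F A g (P.childItvs U l r) l u a)
    (hr : P.RGGTDer F A g (P.childItvs U r l) r v b) :
    P.RGGTDer F A g U (.node l r) (u || v) (min (a + b) (P.K + 1)) := by
  obtain ⟨I, hI, hmI, hdI⟩ := hl
  obtain ⟨J, hJ, hmJ, hdJ⟩ := hr
  have hs := min_add_mem_vals' l r b hb a ha
  obtain ⟨O, hO, hmO, -⟩ := hU.cover _ hs
  refine ⟨O, hO, hmO, ?_⟩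
  rw [hU.mem_min_iff hO hs] at hmO
  have hmO' : Itv.Mem ((a : WithTop ℕ) + b) O := by exact_mod_cast hmO
  have hmlo : Itv.Mem ((I.lo + J.lo : ℕ) : WithTop ℕ) O := by
    have := hU.asc.mem_of_sameItv hO hmO' (sameItv_add_add hq hU hb
      (.inr ⟨_, lo_mem_vals_of_mem_childItvs hI, rfl⟩)
      ⟨I, hI, hmI, le_rfl, hmI.1.trans hmI.2⟩ ⟨J, hJ, hmJ, le_rfl, hmJ.1.trans hmJ.2⟩)
    exact_mod_cast this
  have hmhi : Itv.Mem (I.hi + J.hi) O :=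
    hU.asc.mem_of_sameItv hO hmO' (sameItv_add_add hq hU hb (hi_mem_vals_of_mem_childItvs hI)
      ⟨I, hI, hmI, hmI.1.trans hmI.2, le_rfl⟩ ⟨J, hJ, hmJ, hmJ.1.trans hmJ.2, le_rfl⟩)
  have hlo : O.lo ≤ I.lo + J.lo := by exact_mod_cast hmlo.1
  by_cases h0 : O.lo = 0
  · exact .inl h0
  have hOv : (O, Sum.inr (.node l r, O)) ∈ P.rggtVars U (.node l r) :=
    List.mem_map.2 ⟨O, by simp [hO, Nat.pos_of_ne_zero h0], rfl⟩
  refine .inr ⟨_, hOv, ?_⟩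
  rcases hdI with hI0 | ⟨p, hp, hdp⟩
  · rcases hdJ with hJ0 | ⟨q, hqv, hdq⟩
    · omega
    · refine (hdq.imp (c := [neg q, pos (Sum.inr (.node l r, O))]) (hF ?_)
        (by simp) (by simp) (by simp)).weaken (by simp +contextual)
      rw [rggtClauses]
      refine List.mem_append_left _ (List.mem_append_left _ (List.mem_append_left _
        (List.mem_map.2 ⟨((J, q), (O, Sum.inr (.node l r, O))), ?_, rfl⟩)))
      rw [List.mem_filter, List.mem_product, List.mem_append]
      simp only [decide_eq_true_eq]
      exact ⟨⟨.inr hqv, hOv⟩, by omega, le_trans (le_add_of_nonneg_left (zero_le)) hmhi.2⟩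
  · rcases hdJ with hJ0 | ⟨q, hqv, hdq⟩
    · refine (hdp.imp (c := [neg p, pos (Sum.inr (.node l r, O))]) (hF ?_)
        (by simp) (by simp) (by simp)).weaken (by simp +contextual)
      rw [rggtClauses]
      refine List.mem_append_left _ (List.mem_append_left _ (List.mem_append_left _
        (List.mem_map.2 ⟨((I, p), (O, Sum.inr (.node l r, O))), ?_, rfl⟩)))
      rw [List.mem_filter, List.mem_product, List.mem_append]
      simp only [decide_eq_true_eq]
      exact ⟨⟨.inl hp, hOv⟩, by omega, le_trans (le_add_of_nonneg_right (zero_le)) hmhi.2⟩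
    · refine hdp.imp₂ hdq huv (c := [neg p, neg q, pos (Sum.inr (.node l r, O))]) (hF ?_)
        (by simp) (by simp) (by simp) (by simp)
      rw [rggtClauses]
      refine List.mem_append_left _ (List.mem_append_left _ (List.mem_append_right _
        (List.mem_map.2 ⟨(((I, p), (J, q)), (O, Sum.inr (.node l r, O))), ?_, rfl⟩)))
      rw [List.mem_filter, List.mem_product, List.mem_product]
      simp only [decide_eq_true_eq]
      exact ⟨⟨⟨hp, hqv⟩, hOv⟩, hlo, hmhi.2⟩

theorem rggtDer_tree (hc : P.IsChoice c) (hq : ∀ x, P.q x ≤ P.K) {x : Fin n}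
    (hder : ∀ i y, c i = some y → F.Der A g (i = P.grp x) (Sum.inl y)) {t : BTree (Fin N)}
    {U : List Itv} (hU : P.ItvCover (P.vals t) U) (ht : t.leaves.Nodup)
    (hfix : ∀ y, P.grp y ∈ t.leaves → P.newCoeff y U t = P.q y) (hF : P.rggtClauses U t ⊆ F) :
    P.RGGTDer F A g U t (P.grp x ∈ t.leaves) (min (P.treeLoad c t) (P.K + 1)) := by
  induction t generalizing U with
  | leaf i =>
    have := rggtDer_leaf hc hder hU (fun y hy => hfix y (by simp [BTree.leaves, hy])) hF
    have hle := vals_le hq _ _ (load_mem_vals_leaf hc i)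
    rw [treeLoad_leaf, min_eq_left hle]
    simpa [BTree.leaves] using this
  | node l r hl hr =>
    rw [BTree.leaves, List.nodup_append] at ht
    have h := rggtDer_node hq hU hF (by
        simp only [decide_eq_true_eq]
        exact fun h => ht.2.2 _ h.1 _ h.2 rfl)
      (min_treeLoad_mem_vals hc hq l) (min_treeLoad_mem_vals hc hq r)
      (hl (childItvs_cover hq U l r) ht.1 (fun x hx => by
        rw [← hfix x (by simp [BTree.leaves, hx]), newCoeff, if_pos hx])
        fun c hc => hF (by simp [rggtClauses, hc]))
      (hr (childItvs_cover hq U r l) ht.2.1 (fun x hx => by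
        rw [← hfix x (by simp [BTree.leaves, hx]), newCoeff,
          if_neg fun hx' => ht.2.2 _ hx' _ hx rfl])
        fun c hc => hF (by simp [rggtClauses, hc]))
    have hmin : min (min (P.treeLoad c l) (P.K + 1) + min (P.treeLoad c r) (P.K + 1)) (P.K + 1) =
        min (P.treeLoad c (.node l r)) (P.K + 1) := by
      rw [treeLoad_node]
      omega
    rw [hmin] at h
    simpa [BTree.leaves] using h

end

theorem rggtOfTree_sound {t : BTree (Fin N)} (ht : t.leaves.Perm P.liveGroups) :
    P.Sound (P.rggtOfTree t) := by
  intro c hc hK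
  refine ⟨fun v => v.2.lo ≤ P.treeLoad c v.1, ?_⟩
  rw [rggtOfTree, CNF.sat_append]
  refine ⟨sat_rggtClauses _ _, ?_⟩
  rw [← treeLoad_of_perm_live ht fun i hi => load_eq_zero_of_notMem_liveGroups hc hi] at hK
  simpa [CNF.Sat, neg, Nat.lt_succ_iff] using hK

theorem rggtOfTree_refutes (hq : ∀ x, P.q x ≤ P.K) {t : BTree (Fin N)}
    (ht : t.leaves.Perm P.liveGroups) (hfix : (P.rggtPass t).q = P.q) :
    P.Refutes (P.rggtOfTree t) := by
  intro A g c x hc hx hK hder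
  rw [← treeLoad_of_perm_live ht fun i hi => load_eq_zero_of_notMem_liveGroups hc hi] at hK
  obtain ⟨I, hI, hm, h⟩ := rggtDer_tree (F := P.rggtOfTree t) hc hq hder (rootItvs_cover hq t)
    (ht.nodup_iff.2 nodup_liveGroups) (fun y _ => congrFun hfix y)
    fun c hc => by simp [rggtOfTree, hc]
  -- The capped load is `K + 1`, and disjointness leaves only the upper root interval.
  obtain rfl : I = ⟨P.K + 1, ⊤⟩ := by
    refine (rootItvs_cover hq t).asc.eq_of_mem hI (by simp [rootItvs]) hm ⟨?_, by simp⟩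
    rw [min_eq_right hK]
  obtain ⟨v, hv, hd⟩ := h.resolve_left (by simp)
  cases t with
  | leaf i =>
    have hle : P.load c i ≤ P.K := by
      cases h : c i with
      | none => simp [load, h]
      | some x => rw [load_of_eq_some h]; exact hq x
    rw [treeLoad_leaf] at hK
    omega
  | node l r =>
    rw [show v = Sum.inr (.node l r, ⟨P.K + 1, ⊤⟩) from rggtVars_node hv] at hd
    exact hd.refute (by simp [rggtOfTree])

/-- Choose a variable of largest coefficient in every group. -/
theorem Normalised.exists_overflow (hP : P.Normalised) :
    ∃ c, P.IsChoice c ∧ P.K < ∑ i, P.load c i := by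
  have : ∀ i, ∃ x, P.grp x = i ∧ (Finset.univ.filter fun x => P.grp x = i).sup P.q = P.q x := by
    intro i
    obtain ⟨y, hy⟩ := hP.group_nonempty i
    obtain ⟨x, hx, h⟩ := Finset.exists_mem_eq_sup (Finset.univ.filter fun x => P.grp x = i)
      ⟨y, by simp [hy]⟩ P.q
    exact ⟨x, by simpa using hx, h⟩
  choose f hf hf' using this
  refine ⟨fun i => some (f i), fun i x h => ?_, ?_⟩
  · rw [← Option.some.inj h, hf]
  · refine hP.not_trivial.trans_le (Finset.sum_le_sum fun i _ => ?_)
    rw [hf' i]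
    exact le_rfl

theorem Sound.of_equiv {α : Type*} {Q : PBAMO n N} (hgrp : Q.grp = P.grp)
    (hiff : ∀ c, P.IsChoice c → (∑ i, Q.load c i ≤ Q.K ↔ ∑ i, P.load c i ≤ P.K))
    {F : CNF (Fin n ⊕ α)} (h : Q.Sound F) : P.Sound F := by
  intro c hc hK
  have hc' : Q.IsChoice c := fun i x hx => hgrp ▸ hc i x hx
  have heq : Q.assignment c = P.assignment c := by
    funext x
    rw [assignment, assignment, hgrp]
  exact heq ▸ h c hc' ((hiff c hc).2 hK)

theorem Refutes.of_equiv {α : Type*} {Q : PBAMO n N} (hgrp : Q.grp = P.grp)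
    (hiff : ∀ c, P.IsChoice c → (∑ i, Q.load c i ≤ Q.K ↔ ∑ i, P.load c i ≤ P.K))
    {F : CNF (Fin n ⊕ α)} (h : Q.Refutes F) : P.Refutes F := by
  intro A g c x hc hx hK hder
  have hc' : Q.IsChoice c := fun i x hx => hgrp ▸ hc i x hx
  refine h A g c x hc' (by rw [hgrp, hx]) ?_ (by rwa [hgrp])
  rw [← not_le] at hK ⊢
  rwa [hiff c hc]

theorem rggt_sound_refutes (hP : P.Normalised) {build : PBAMO n N → BTree (Fin N)}
    (hb : ∀ Q : PBAMO n N, Q.liveGroups ≠ [] → (build Q).leaves.Perm Q.liveGroups) :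
    P.Sound (P.rggt build) ∧ P.Refutes (P.rggt build) := by
  obtain ⟨hgrp, hK, hle, hiff, hperm, hfix⟩ := rggtReduce_spec hb P hP.q_le hP.exists_overflow
  rw [← hK] at hiff
  have hiff' : ∀ c, P.IsChoice c → (∑ i, (rggtReduce build P).load c i ≤ (rggtReduce build P).K ↔
      ∑ i, P.load c i ≤ P.K) := by
    rwa [hK] at hiff ⊢
  exact ⟨(rggtOfTree_sound hperm).of_equiv hgrp hiff',
    (rggtOfTree_refutes (fun x => hK ▸ (hle x).trans (hP.q_le x)) hperm hfix).of_equiv hgrp hiff'⟩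

end PBAMO

/-! ### Unary numbers and their adders -/

/-- The wire is true if the variables with `T` are. -/
def Wire.Holds {W : Type*} (T : W → Prop) : Wire W → Prop
  | .one => True
  | .var w => T w

/-- At least the first `k` elements of `a` are true. -/
def AtLeast {W : Type*} (T : W → Prop) (a : List (Wire W)) (k : ℕ) : Prop :=
  ∀ i < k, ∃ v, a[i]? = some v ∧ v.Holds T

/-- At most the first `k` elements of `a` are true. -/
def AtMost {W : Type*} (T : W → Prop) (a : List (Wire W)) (k : ℕ) : Prop :=
  ∀ i v, a[i]? = some v → v.Holds T → i < k

/-- The variables with `T` include those that unit propagation derives from them by clauses with a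
single positive literal. -/
def HornClosed {W : Type*} (T : W → Prop) (F : CNF W) : Prop :=
  ∀ c ∈ F, ∀ o, pos o ∈ c → (∀ l ∈ c, l ≠ pos o → ∃ w, l = neg w ∧ T w) → T o

/-- This reduces forward propagation in a watchdog to closure of a set of variables, also for a
renamed copy inside a larger formula. -/
theorem hornClosed_up {W W' : Type*} (f : W → W') {F : CNF W} {F' : CNF W'}
    {A : Set (Literal W')} (h : F.rename f ⊆ F') :
    HornClosed (fun w => F'.UP A (pos (f w))) F := by
  intro c hc o ho hl
  refine .propagated (c.map (Literal.rename f)) _ (h (List.mem_map.2 ⟨c, hc, rfl⟩))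
    (List.mem_map.2 ⟨_, ho, rfl⟩) fun l' hl' hne => ?_
  obtain ⟨l, hlc, rfl⟩ := List.mem_map.1 hl'
  obtain ⟨w, rfl, hw⟩ := hl l hlc fun h => hne (h ▸ rfl)
  exact hw

section

variable {W : Type*} {T : W → Prop} {F : CNF W} {a b : List (Wire W)} {i j : ℕ}

theorem AtLeast.le_length (h : AtLeast T a i) : i ≤ a.length := by
  by_contra! hlt
  obtain ⟨v, hv, -⟩ := h _ hlt
  simp at hv

theorem atLeast_range {o : ℕ → W} {len : ℕ} (hi : i ≤ len) (h : ∀ k, 1 ≤ k → k ≤ i → T (o k)) :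
    AtLeast T ((List.range' 1 len).map fun k => .var (o k)) i := by
  intro k hk
  refine ⟨.var (o (1 + k)), ?_, h _ (by omega) (by omega)⟩
  rw [List.getElem?_map, List.getElem?_range' (by omega)]
  simp

theorem atMost_range {o : ℕ → W} {len : ℕ} (h : ∀ k, T (o k) → k ≤ i) :
    AtMost T ((List.range' 1 len).map fun k => .var (o k)) i := by
  intro k v hv hT
  rw [List.getElem?_map] at hv
  obtain ⟨m, hm, rfl⟩ := Option.map_eq_some_iff.1 hv
  rw [List.getElem?_eq_some_iff] at hm
  obtain ⟨hk, rfl⟩ := hm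
  have := h _ hT
  simp only [List.getElem_range'] at this
  omega

/-- List positions start from 0: the element numbered `2 * (k + 1)` from 1 is at position `2 * k +
1`. -/
theorem PW.getElem?_half (k : ℕ) : (PW.half a)[k]? = a[2 * k + 1]? := by
  have h : PW.half a = (List.range (a.length / 2)).map fun k => a.getD (2 * k + 1) .one := by
    rw [PW.half, ← List.filterMap_eq_map]
    refine List.filterMap_congr fun k hk => ?_
    rw [List.mem_range] at hk
    rw [Function.comp_apply, List.getD_eq_getElem _ _ (by omega), List.getElem?_eq_getElem]
  rw [h, List.getElem?_map]
  by_cases hk : k < a.length / 2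
  · rw [List.getElem?_range hk, Option.map_some, List.getD_eq_getElem _ _ (by omega),
      List.getElem?_eq_getElem]
  · rw [List.getElem?_eq_none (by simpa using hk), List.getElem?_eq_none (by omega)]
    rfl

theorem AtLeast.half (h : AtLeast T a i) : AtLeast T (PW.half a) (i / 2) := by
  intro k hk
  rw [PW.getElem?_half]
  exact h _ (by omega)

theorem AtMost.half (h : AtMost T a i) : AtMost T (PW.half a) (i / 2) := by
  intro k v hv hT
  rw [PW.getElem?_half] at hv
  have := h _ _ hv hT
  omega

theorem AtLeast.negLits (h : AtLeast T a i) {t : ℕ} (ht : t ≤ i) :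
    ∀ l ∈ ((Wire.one :: a).getD t Wire.one).negLits, ∃ w, l = neg w ∧ T w := by
  cases t with
  | zero => simp [Wire.negLits]
  | succ t =>
    obtain ⟨v, hv, hT⟩ := h t ht
    rw [List.getD_cons_succ, List.getD_eq_getElem?_getD, hv, Option.getD_some]
    cases v with
    | one => simp [Wire.negLits]
    | var w => exact fun l hl => ⟨w, List.mem_singleton.1 hl, hT⟩

theorem AtMost.exists_negLits {τ : W → Bool} (h : AtMost (fun w => τ w = true) a i) {t : ℕ}
    (ht : i < t) (hta : t ≤ a.length) :
    ∃ l ∈ ((Wire.one :: a).getD t Wire.one).negLits, τ l.var = l.sign := by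
  obtain ⟨t, rfl⟩ : ∃ t', t = t' + 1 := ⟨t - 1, by omega⟩
  rw [List.getD_cons_succ, List.getD_eq_getElem _ _ hta]
  have hv : a[t]? = some a[t] := List.getElem?_eq_getElem hta
  revert hv
  generalize a[t] = v
  intro hv
  cases v with
  | one => exact absurd (h _ _ hv trivial) (by omega)
  | var w =>
    refine ⟨neg w, by simp [Wire.negLits], ?_⟩
    have : ¬ τ w = true := fun hw => absurd (h _ _ hv hw) (by omega)
    simpa [neg] using this

theorem unaryAdder_derives (hT : HornClosed T F) {both : Bool} {o : ℕ → W}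
    (hF : unaryAdder both a b o ⊆ F) (ha : AtLeast T a i) (hb : AtLeast T b j) :
    ∀ k, 1 ≤ k → k ≤ i + j → T (o k) := by
  intro k hk hk'
  have hla := ha.le_length
  have hlb := hb.le_length
  -- Split `k` into a part at most `i` and a rest at most `j`; the adder has a clause for exactly
  -- this pair.
  have hsum : min k i + (k - min k i) = k := by omega
  refine hT (((Wire.one :: a).getD (min k i) Wire.one).negLits ++
    ((Wire.one :: b).getD (k - min k i) Wire.one).negLits ++ [pos (o k)]) (hF ?_) _ (by simp) ?_
  · refine List.mem_flatMap.2 ⟨(min k i, k - min k i), ?_, List.mem_append_left _ ?_⟩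
    · rw [List.mem_product, List.mem_range, List.mem_range]
      omega
    · dsimp only
      rw [hsum, if_neg (by omega)]
      simp
  · intro l hl hne
    rw [List.mem_append, List.mem_append, List.mem_singleton] at hl
    rcases hl with (hl | hl) | hl
    · exact ha.negLits (by omega) l hl
    · exact hb.negLits (by omega) l hl
    · exact absurd hl hne

theorem sat_posClause {τ : W → Bool} {L : List (Wire W)} {c : Clause W}
    (h : (∃ v ∈ L, v.Holds fun w => τ w = true) ∨ ∃ l ∈ c, τ l.var = l.sign) :
    (posClause L c).Sat τ := by
  unfold posClause
  split_ifs with hL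
  · simp [CNF.Sat]
  · intro cl hcl
    rw [List.mem_singleton] at hcl
    subst hcl
    rcases h with ⟨v, hv, hT⟩ | ⟨l, hl, hT⟩
    · cases v with
      | one => exact absurd (List.any_eq_true.2 ⟨_, hv, rfl⟩) hL
      | var w =>
        exact ⟨pos w, List.mem_append_left _ (List.mem_flatMap.2 ⟨_, hv, by simp⟩), hT⟩
    · exact ⟨l, List.mem_append_right _ hl, hT⟩

/-- The inputs and output are exact counts here, so the optional clauses hold too: with fewer than
`s + 1` and `t + 1` true inputs, the output is below `s + t + 1`. -/
theorem sat_unaryAdder {τ : W → Bool} {both : Bool} {o : ℕ → W}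
    (ha : AtLeast (fun w => τ w = true) a i) (ha' : AtMost (fun w => τ w = true) a i)
    (hb : AtLeast (fun w => τ w = true) b j) (hb' : AtMost (fun w => τ w = true) b j)
    (ho : ∀ k, τ (o k) = true ↔ k ≤ i + j) : (unaryAdder both a b o).Sat τ := by
  intro cl hcl
  obtain ⟨⟨s, t⟩, hst, hcl⟩ := List.mem_flatMap.1 hcl
  rw [List.mem_product, List.mem_range, List.mem_range] at hst
  rcases List.mem_append.1 hcl with hcl | hcl
  · dsimp only at hcl
    split_ifs at hcl
    · cases hcl
    rw [List.mem_singleton] at hcl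
    subst hcl
    by_cases hs : s ≤ i
    · by_cases ht : t ≤ j
      · exact ⟨pos (o (s + t)), by simp, (ho _).2 (by omega)⟩
      · obtain ⟨l, hl, h⟩ := hb'.exists_negLits (not_le.1 ht) (by omega)
        exact ⟨l, by simp only [List.mem_append]; exact .inl (.inr hl), h⟩
    · obtain ⟨l, hl, h⟩ := ha'.exists_negLits (not_le.1 hs) (by omega)
      exact ⟨l, by simp only [List.mem_append]; exact .inl (.inl hl), h⟩
  · split_ifs at hcl
    · refine sat_posClause ?_ cl hcl
      by_cases hs : s < i
      · obtain ⟨v, hv, h⟩ := ha s hs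
        exact .inl ⟨v, by simp [hv], h⟩
      by_cases ht : t < j
      · obtain ⟨v, hv, h⟩ := hb t ht
        exact .inl ⟨v, by simp [hv], h⟩
      · refine .inr ⟨_, List.mem_singleton_self _, ?_⟩
        have : ¬ τ (o (s + t + 1)) = true := by
          rw [ho]
          omega
        simpa [neg] using this
    · cases hcl

end

/-! ### Polynomial watchdogs -/

namespace PW

variable {n N : ℕ} {D : PW n N} {c : Fin N → Option (Fin n)}

/-- The value of `y_{i,r}`. -/
def bit (D : PW n N) (c : Fin N → Option (Fin n)) (i : Fin N) (r : ℕ) : Bool :=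
  (D.P.load c i).testBit r

/-- The value of an element of bucket `r`. -/
def bitVal (D : PW n N) (c : Fin N → Option (Fin n)) (r : ℕ) : Option (Fin N) → ℕ
  | none => 1
  | some i => (D.bit c i r).toNat

/-- The sum of the leaves of a tree of the totalizer of bucket `r`. -/
def totVal (D : PW n N) (c : Fin N → Option (Fin n)) (r : ℕ) (t : BTree (Option (Fin N))) : ℕ :=
  (t.leaves.map (D.bitVal c r)).sum

/-- The value of `U(B_r)`. -/
def uVal (D : PW n N) (c : Fin N → Option (Fin n)) (r : ℕ) : ℕ :=
  ((D.bucket r).map (D.bitVal c r)).sum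

/-- The value of `S_r`. -/
def sVal (D : PW n N) (c : Fin N → Option (Fin n)) : ℕ → ℕ
  | 0 => D.uVal c 0
  | r + 1 => D.uVal c (r + 1) + sVal D c r / 2

/-- The values of the variables of the formula. -/
def model (D : PW n N) (c : Fin N → Option (Fin n)) : Fin n ⊕ PWVar N → Bool :=
  Sum.elim (D.P.assignment c) fun
    | .y i r => D.bit c i r
    | .tot r t k => k ≤ D.totVal c r t
    | .s r k => k ≤ D.sVal c r

theorem mem_bitVars {i : Fin N} {r : ℕ} {x : Fin n} :
    x ∈ D.bitVars i r ↔ D.P.grp x = i ∧ (D.P.q x).testBit r = true := by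
  simp [bitVars, PBAMO.mem_group]

theorem bit_eq_true (hc : D.P.IsChoice c) {i : Fin N} {r : ℕ} :
    D.bit c i r = true ↔ ∃ x, c i = some x ∧ x ∈ D.bitVars i r := by
  rw [bit]
  cases h : c i with
  | none => simp [PBAMO.load_of_eq_none h]
  | some x => simp [PBAMO.load_of_eq_some h, mem_bitVars, hc _ _ h]

theorem bit_of_yVar_eq_none (hc : D.P.IsChoice c) {i : Fin N} {r : ℕ} (h : D.yVar i r = none) :
    D.bit c i r = false := by
  rw [← Bool.not_eq_true, bit_eq_true hc]
  rintro ⟨x, -, hx⟩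
  unfold yVar at h
  split_ifs at h
  split at h
  · simp_all
  · cases h
  · cases h

theorem model_yVar (hc : D.P.IsChoice c) {i : Fin N} {r : ℕ} {v : Fin n ⊕ PWVar N}
    (h : D.yVar i r = some v) : D.model c v = D.bit c i r := by
  unfold yVar at h
  split_ifs at h
  · split at h
    · cases h
    · rename_i x hx
      obtain rfl := Option.some.inj h
      have hxi : x ∈ D.bitVars i r := by simp [hx]
      rw [Bool.eq_iff_iff, bit_eq_true hc, hx]
      simp only [model, Sum.elim_inl, PBAMO.assignment_eq_true, (mem_bitVars.1 hxi).1,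
        List.mem_singleton, exists_eq_right]
    · obtain rfl := Option.some.inj h
      rfl
  · obtain rfl := Option.some.inj h
    rfl

/-- Covers the implementations of `y_{i,r}`: a new variable is reached through its clause, and a
sole bit variable is the chosen one itself. -/
theorem yVar_derived {T : Fin n ⊕ PWVar N → Prop} (hc : D.P.IsChoice c) {i : Fin N} {r : ℕ}
    (hT : HornClosed T (D.yClauses i r)) (hx : ∀ x, c i = some x → T (Sum.inl x))
    {v : Fin n ⊕ PWVar N} (h : D.yVar i r = some v) (hbit : D.bit c i r = true) : T v := by
  obtain ⟨x, hxi, hxr⟩ := (bit_eq_true hc).1 hbit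
  have key : ¬ (D.opt = true ∧ (D.bitVars i r).length ≤ 1) → T (Sum.inr (.y i r)) := by
    intro hlen
    rw [yClauses, if_neg hlen] at hT
    refine hT _ (List.mem_map.2 ⟨x, hxr, rfl⟩) _ (by simp) ?_
    simp only [List.mem_cons, List.not_mem_nil, or_false]
    rintro l (rfl | rfl) hne
    · exact ⟨_, rfl, hx x hxi⟩
    · exact absurd rfl hne
  unfold yVar at h
  split_ifs at h with hopt
  · split at h
    · cases h
    · rename_i z hz
      obtain rfl := Option.some.inj h
      obtain rfl : x = z := by simpa [hz] using hxr
      exact hx x hxi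
    · rename_i h0 h1
      obtain rfl := Option.some.inj h
      refine key fun h => ?_
      have hlen := h.2
      match hL : D.bitVars i r, hlen with
      | [], _ => exact h0 hL
      | [z], _ => exact h1 z hL
  · obtain rfl := Option.some.inj h
    exact key fun h => hopt h.1

theorem sat_yClauses (i : Fin N) (r : ℕ) : (D.yClauses i r).Sat (D.model c) := by
  unfold yClauses
  split_ifs
  · simp [CNF.Sat]
  · intro cl hcl
    obtain ⟨x, hx, rfl⟩ := List.mem_map.1 hcl
    rw [mem_bitVars] at hx
    by_cases h : D.P.assignment c x = true
    · refine ⟨pos (Sum.inr (.y i r)), by simp, ?_⟩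
      simp only [pos, model, Sum.elim_inr, bit]
      rw [← hx.1, PBAMO.load_of_assignment h, hx.2]
    · exact ⟨_, List.mem_cons_self, by simpa [neg, model] using h⟩

/-! #### Totalizers -/

@[simp] theorem totVal_node (r : ℕ) (a b : BTree (Option (Fin N))) :
    D.totVal c r (.node a b) = D.totVal c r a + D.totVal c r b := by
  simp [totVal, BTree.leaves]

theorem totOut_length {r : ℕ} {t : BTree (Option (Fin N))}
    (ht : ∀ i, some i ∈ t.leaves → (D.yVar i r).isSome) :
    (D.totOut r t).length = t.leaves.length := by
  cases t with
  | leaf e =>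
    cases e with
    | none => rfl
    | some i =>
      obtain ⟨v, hv⟩ := Option.isSome_iff_exists.1 (ht i (by simp [BTree.leaves]))
      simp [totOut, hv, BTree.leaves]
  | node a b => simp [totOut]

theorem totOut_derived {T : Fin n ⊕ PWVar N → Prop} {r : ℕ} {t : BTree (Option (Fin N))}
    (ht : ∀ i, some i ∈ t.leaves → (D.yVar i r).isSome)
    (hy : ∀ i, some i ∈ t.leaves → ∀ v, D.yVar i r = some v → D.bit c i r = true → T v)
    (hT : HornClosed T (D.totClauses r t)) : AtLeast T (D.totOut r t) (D.totVal c r t) := by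
  induction t with
  | leaf e =>
    cases e with
    | none =>
      intro k hk
      obtain rfl : k = 0 := by simpa [totVal, BTree.leaves, bitVal] using hk
      exact ⟨.one, rfl, trivial⟩
    | some i =>
      obtain ⟨v, hv⟩ := Option.isSome_iff_exists.1 (ht i (by simp [BTree.leaves]))
      intro k hk
      have hk' : k < (D.bit c i r).toNat := by simpa [totVal, BTree.leaves, bitVal] using hk
      have hle := Bool.toNat_le (D.bit c i r)
      obtain rfl : k = 0 := by omega
      refine ⟨.var v, by simp [totOut, hv], hy i (by simp [BTree.leaves]) v hv ?_⟩
      by_contra h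
      rw [Bool.not_eq_true] at h
      rw [h] at hk'
      exact absurd hk' (Nat.not_lt_zero _)
  | node a b iha ihb =>
    have hta : ∀ i, some i ∈ a.leaves → (D.yVar i r).isSome :=
      fun i hi => ht i (by simp [BTree.leaves, hi])
    have htb : ∀ i, some i ∈ b.leaves → (D.yVar i r).isSome :=
      fun i hi => ht i (by simp [BTree.leaves, hi])
    have ha := iha hta (fun i hi => hy i (by simp [BTree.leaves, hi]))
      fun c hc => hT c (by simp [totClauses, hc])
    have hb := ihb htb (fun i hi => hy i (by simp [BTree.leaves, hi]))
      fun c hc => hT c (by simp [totClauses, hc])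
    refine atLeast_range ?_ ?_
    -- The node has one output per leaf, enough for the sum of its children's values.
    · have hla := ha.le_length
      have hlb := hb.le_length
      rw [totOut_length hta] at hla
      rw [totOut_length htb] at hlb
      simp only [BTree.leaves, List.length_append, totVal_node]
      omega
    · rw [totVal_node]
      exact unaryAdder_derives hT (both := D.both) (o := fun k => Sum.inr (.tot r (.node a b) k))
        (fun c hc => by simp [totClauses, hc]) ha hb

theorem model_totOut (hc : D.P.IsChoice c) {r : ℕ} {t : BTree (Option (Fin N))}
    (ht : ∀ i, some i ∈ t.leaves → (D.yVar i r).isSome) :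
    AtLeast (fun w => D.model c w = true) (D.totOut r t) (D.totVal c r t) ∧
      AtMost (fun w => D.model c w = true) (D.totOut r t) (D.totVal c r t) ∧
      (D.totClauses r t).Sat (D.model c) := by
  induction t with
  | leaf e =>
    refine ⟨totOut_derived ht (fun i _ v hv h => by rwa [model_yVar hc hv]) ?_, ?_, ?_⟩
    · simp [HornClosed, totClauses]
    · intro k v hv hT
      have hlen := (List.getElem?_eq_some_iff.1 hv).1
      rw [totOut_length ht] at hlen
      obtain rfl : k = 0 := by simpa [BTree.leaves] using hlen
      cases e with
      | none => simp [totVal, BTree.leaves, bitVal]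
      | some i =>
        obtain ⟨w, hw⟩ := Option.isSome_iff_exists.1 (ht i (by simp [BTree.leaves]))
        obtain rfl : Wire.var w = v := by simpa [totOut, hw] using hv
        have : D.bit c i r = true := by rw [← model_yVar hc hw]; exact hT
        simp [totVal, BTree.leaves, bitVal, this]
    · simp [CNF.Sat, totClauses]
  | node a b iha ihb =>
    have hta : ∀ i, some i ∈ a.leaves → (D.yVar i r).isSome :=
      fun i hi => ht i (by simp [BTree.leaves, hi])
    have htb : ∀ i, some i ∈ b.leaves → (D.yVar i r).isSome :=
      fun i hi => ht i (by simp [BTree.leaves, hi])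
    obtain ⟨a1, a2, a3⟩ := iha hta
    obtain ⟨b1, b2, b3⟩ := ihb htb
    have hmodel : ∀ k, D.model c (Sum.inr (.tot r (.node a b) k)) = true ↔
        k ≤ D.totVal c r (.node a b) := fun k => decide_eq_true_iff
    refine ⟨atLeast_range ?_ fun k _ hk => (hmodel k).2 hk,
      atMost_range fun k hk => (hmodel k).1 hk, ?_⟩
    · have hla := a1.le_length
      have hlb := b1.le_length
      rw [totOut_length hta] at hla
      rw [totOut_length htb] at hlb
      simp only [BTree.leaves, List.length_append, totVal_node]
      omega
    · rw [totClauses, CNF.sat_append, CNF.sat_append]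
      refine ⟨⟨sat_unaryAdder a1 a2 b1 b2 fun k => ?_, a3⟩, b3⟩
      rw [hmodel, totVal_node]

theorem mem_bucket {r : ℕ} {i : Fin N} :
    some i ∈ D.bucket r ↔ i ∈ D.G ∧ (D.yVar i r).isSome := by
  rw [bucket, List.mem_append]
  constructor
  · rintro (h | h)
    · split_ifs at h <;> simp at h
    · simpa using h
  · intro h
    exact .inr (by simpa using h)

theorem U_derived {T : Fin n ⊕ PWVar N → Prop} (hD : D.TreesOK) {r : ℕ} (hr : r ≤ D.p)
    (hy : ∀ i ∈ D.G, ∀ v, D.yVar i r = some v → D.bit c i r = true → T v)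
    (hT : HornClosed T (D.phi r)) : AtLeast T (D.U r) (D.uVal c r) := by
  unfold U uVal
  unfold phi at hT
  split_ifs at hT ⊢ with h
  · simp [h, AtLeast]
  · have hp := hD r hr h
    have hmem : ∀ i, some i ∈ (D.tree r).leaves → i ∈ D.G ∧ (D.yVar i r).isSome :=
      fun i hi => mem_bucket.1 (hp.subset hi)
    rw [← (hp.map _).sum_eq]
    exact totOut_derived (fun i hi => (hmem i hi).2) (fun i hi => hy i (hmem i hi).1) hT

theorem model_U (hc : D.P.IsChoice c) (hD : D.TreesOK) {r : ℕ} (hr : r ≤ D.p) :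
    AtLeast (fun w => D.model c w = true) (D.U r) (D.uVal c r) ∧
      AtMost (fun w => D.model c w = true) (D.U r) (D.uVal c r) ∧
      (D.phi r).Sat (D.model c) := by
  unfold U uVal phi
  split_ifs with h
  · simp [h, AtLeast, AtMost, CNF.Sat]
  · have hp := hD r hr h
    have hmem : ∀ i, some i ∈ (D.tree r).leaves → i ∈ D.G ∧ (D.yVar i r).isSome :=
      fun i hi => mem_bucket.1 (hp.subset hi)
    rw [← (hp.map _).sum_eq]
    exact model_totOut hc fun i hi => (hmem i hi).2

/-! #### The adders of the buckets -/

theorem S_derived {T : Fin n ⊕ PWVar N → Prop} (hc : D.P.IsChoice c) (hD : D.TreesOK)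
    (hx : ∀ i ∈ D.G, ∀ x, c i = some x → T (Sum.inl x)) (hT : HornClosed T D.formula) {r : ℕ}
    (hr : r ≤ D.p) : AtLeast T (D.S r) (D.sVal c r) := by
  have hU : ∀ r ≤ D.p, AtLeast T (D.U r) (D.uVal c r) := fun r hr => by
    refine U_derived hD hr (fun i hi v hv hbit => yVar_derived hc ?_ (hx i hi) hv hbit) ?_
    · refine fun cl hcl => hT cl (List.mem_append_right _ (List.mem_flatMap.2
        ⟨r, List.mem_range.2 (by omega), List.mem_flatMap.2 ⟨i, ?_, hcl⟩⟩))
      simp [hi]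
    · exact fun cl hcl => hT cl (List.mem_append_left _ (List.mem_append_left _
        (List.mem_flatMap.2 ⟨r, List.mem_range.2 (by omega), hcl⟩)))
  induction r with
  | zero => exact hU 0 hr
  | succ r ih =>
    have h1 := hU _ hr
    have h2 := (ih (by omega)).half
    have hl1 := h1.le_length
    have hl2 := h2.le_length
    refine atLeast_range (by rw [sVal]; omega) ?_
    refine unaryAdder_derives hT (both := D.both) (o := fun k => Sum.inr (.s (r + 1) k))
      (fun cl hcl => ?_) h1 h2
    refine List.mem_append_left _ (List.mem_append_right _ (List.mem_flatMap.2
      ⟨r + 1, List.mem_range'_1.2 (by omega), ?_⟩))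
    exact hcl

theorem model_S (hc : D.P.IsChoice c) (hD : D.TreesOK) {r : ℕ} (hr : r ≤ D.p) :
    AtLeast (fun w => D.model c w = true) (D.S r) (D.sVal c r) ∧
      AtMost (fun w => D.model c w = true) (D.S r) (D.sVal c r) ∧
      (1 ≤ r → (D.psi r).Sat (D.model c)) := by
  induction r with
  | zero => exact ⟨(model_U hc hD hr).1, (model_U hc hD hr).2.1, by simp⟩
  | succ r ih =>
    obtain ⟨u1, u2, -⟩ := model_U hc hD hr
    obtain ⟨s1, s2, -⟩ := ih (by omega)
    have hl1 := u1.le_length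
    have hl2 := s1.half.le_length
    have hmodel : ∀ k, D.model c (Sum.inr (.s (r + 1) k)) = true ↔ k ≤ D.sVal c (r + 1) :=
      fun k => decide_eq_true_iff
    exact ⟨atLeast_range (by rw [sVal]; omega) fun k _ hk => (hmodel k).2 hk,
      atMost_range fun k hk => (hmodel k).1 hk,
      fun _ => sat_unaryAdder u1 u2 s1.half s2.half hmodel⟩

theorem sat_formula (hc : D.P.IsChoice c) (hD : D.TreesOK) : D.formula.Sat (D.model c) := by
  rw [formula, CNF.sat_append, CNF.sat_append]
  refine ⟨⟨?_, ?_⟩, ?_⟩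
  · intro cl hcl
    obtain ⟨r, hr, hcl⟩ := List.mem_flatMap.1 hcl
    rw [List.mem_range] at hr
    exact (model_U hc hD (by omega)).2.2 cl hcl
  · intro cl hcl
    obtain ⟨r, hr, hcl⟩ := List.mem_flatMap.1 hcl
    rw [List.mem_range'_1] at hr
    exact (model_S hc hD (by omega)).2.2 hr.1 cl hcl
  · intro cl hcl
    obtain ⟨r, -, hcl⟩ := List.mem_flatMap.1 hcl
    obtain ⟨i, -, hcl⟩ := List.mem_flatMap.1 hcl
    exact sat_yClauses i r cl hcl

/-! #### The value of the output -/

theorem sum_testBit (x k : ℕ) :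
    ∑ r ∈ Finset.range k, (x.testBit r).toNat * 2 ^ r = x % 2 ^ k := by
  induction k with
  | zero => simp [Nat.mod_one]
  | succ k ih => rw [Finset.sum_range_succ, ih, Nat.mod_pow_succ, Nat.toNat_testBit]; ring

/-- Omitted variables `y_{i,r}` have value zero, so the sum may run over all groups in `G`. -/
theorem uVal_eq (hc : D.P.IsChoice c) (r : ℕ) :
    D.uVal c r = (D.T.testBit r).toNat + ∑ i ∈ D.G, (D.bit c i r).toNat := by
  rw [uVal, bucket, List.map_append, List.sum_append]
  congr 1
  · cases D.T.testBit r <;> simp [bitVal]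
  · rw [List.map_map, ← List.sum_toFinset _ ((List.nodup_finRange N).filter _)]
    refine Finset.sum_subset (fun i hi => ?_) fun i hi h => ?_
    · simp only [List.mem_toFinset, List.mem_filter, decide_eq_true_eq] at hi
      exact hi.2.1
    · simp only [List.mem_toFinset, List.mem_filter, decide_eq_true_eq, List.mem_finRange,
        true_and, not_and, Bool.not_eq_true, Option.isSome_eq_false_iff,
        Option.isNone_iff_eq_none] at h
      simp [bitVal, bit_of_yVar_eq_none hc (h hi)]

/-- Each step keeps the carry of the lower buckets; nested halving with rounding down is one
division by the power of two. -/
theorem sVal_eq (r : ℕ) :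
    D.sVal c r = (∑ k ∈ Finset.range (r + 1), D.uVal c k * 2 ^ k) / 2 ^ r := by
  induction r with
  | zero => simp [sVal]
  | succ r ih =>
    rw [sVal, ih, Finset.sum_range_succ _ (r + 1), Nat.add_mul_div_right _ _ (by positivity),
      Nat.div_div_eq_div_mul, ← pow_succ, add_comm]

theorem T_lt : D.T < 2 ^ D.p := Nat.mod_lt _ (by positivity)

theorem m_mul : D.m * 2 ^ D.p = D.K + 1 + D.T := by
  refine Nat.div_mul_cancel ?_
  unfold T
  have hpos : 0 < 2 ^ D.p := by positivity
  generalize 2 ^ D.p = M at hpos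
  generalize D.K + 1 = s
  have h1 := Nat.mod_lt s hpos
  have h2 := Nat.div_add_mod s M
  rcases Nat.eq_zero_or_pos (s % M) with h | h
  · rw [h, Nat.sub_zero, Nat.mod_self, add_zero]
    exact Nat.dvd_of_mod_eq_zero h
  · rw [Nat.mod_eq_of_lt (by omega : M - s % M < M)]
    refine ⟨s / M + 1, ?_⟩
    rw [mul_add, mul_one]
    omega

/-- Bits `0` to `p` determine every coefficient, so the weighted bucket sum is `T` plus the load.
Comparing it with `m * 2 ^ p = K + 1 + T` cancels `T`. -/
theorem m_le_sVal_iff (hc : D.P.IsChoice c) :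
    D.m ≤ D.sVal c D.p ↔ D.K < ∑ i ∈ D.G, D.P.load c i := by
  have hload : ∀ i ∈ D.G, D.P.load c i < 2 ^ (D.p + 1) := by
    intro i hi
    cases h : c i with
    | none =>
      rw [PBAMO.load_of_eq_none h]
      positivity
    | some x =>
      rw [PBAMO.load_of_eq_some h]
      refine lt_of_le_of_lt ?_ (Nat.lt_pow_succ_log_self one_lt_two _)
      exact Finset.le_sup (f := D.P.q) (by simpa [hc _ _ h] using hi)
  have hsum : ∑ k ∈ Finset.range (D.p + 1), D.uVal c k * 2 ^ k =
      D.T + ∑ i ∈ D.G, D.P.load c i := by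
    simp only [uVal_eq hc, add_mul, Finset.sum_add_distrib, sum_testBit, Finset.sum_mul]
    congr 1
    · exact Nat.mod_eq_of_lt (T_lt.trans (Nat.pow_lt_pow_right one_lt_two (Nat.lt_succ_self _)))
    · rw [Finset.sum_comm]
      refine Finset.sum_congr rfl fun i hi => ?_
      unfold bit
      rw [sum_testBit, Nat.mod_eq_of_lt (hload i hi)]
  rw [sVal_eq, hsum, Nat.le_div_iff_mul_le (by positivity), m_mul]
  omega

theorem m_pos : 0 < D.m := by
  have := m_mul (D := D)
  rcases Nat.eq_zero_or_pos D.m with h | h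
  · rw [h, zero_mul] at this
    omega
  · exact h

theorem sat_notOutput (hc : D.P.IsChoice c) (hD : D.TreesOK) {cl : Clause (Fin n ⊕ PWVar N)}
    (h : ∑ i ∈ D.G, D.P.load c i ≤ D.K ∨ ∃ l ∈ cl, D.model c l.var = l.sign) :
    (D.notOutput cl).Sat (D.model c) := by
  unfold notOutput
  split
  · simp [CNF.Sat]
  · rename_i w hw
    intro cl' hcl
    rw [List.mem_singleton] at hcl
    subst hcl
    rcases h with h | ⟨l, hl, h⟩
    · have hnot : ¬ w.Holds fun w => D.model c w = true := fun hT => by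
        have h1 := (model_S hc hD le_rfl).2.1 _ _ hw hT
        have h2 := (m_le_sVal_iff (D := D) hc).1 (by omega)
        omega
      cases w with
      | one => exact absurd trivial hnot
      | var v => exact ⟨neg v, by simp [Wire.negLits], by simpa [neg, Wire.Holds] using hnot⟩
    · exact ⟨l, List.mem_append_right _ hl, h⟩

/-- If the sum is over `K`, then the formula contains a clause stating that the output is false or
`cl` holds, and the output is derived. -/
theorem exists_output {T : Fin n ⊕ PWVar N → Prop} (hc : D.P.IsChoice c) (hD : D.TreesOK)
    (hx : ∀ i ∈ D.G, ∀ x, c i = some x → T (Sum.inl x)) (hT : HornClosed T D.formula)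
    (hK : D.K < ∑ i ∈ D.G, D.P.load c i) :
    ∃ L : Clause (Fin n ⊕ PWVar N), (∀ l ∈ L, ∃ w, l = neg w ∧ T w) ∧
      ∀ cl, L ++ cl ∈ D.notOutput cl := by
  have hm := (m_le_sVal_iff (D := D) hc).2 hK
  obtain ⟨v, hv, hvT⟩ := S_derived hc hD hx hT le_rfl (D.m - 1)
    (by have := m_pos (D := D); omega)
  refine ⟨v.negLits, ?_, fun cl => by simp [notOutput, hv]⟩
  cases v with
  | one => simp [Wire.negLits]
  | var w => exact fun l hl => ⟨w, List.mem_singleton.1 hl, hvT⟩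

end PW

/-! ### Global and local watchdog encodings. -/

namespace PBAMO

variable {n N : ℕ} {P : PBAMO n N} {opt both : Bool}

theorem ggpw_sound {tree : ℕ → BTree (Option (Fin N))} (hD : (P.watchdog opt both tree).TreesOK) :
    P.Sound (P.ggpw opt both tree) := by
  intro c hc hK
  exact ⟨_, (CNF.sat_append _ _ _).2 ⟨PW.sat_formula hc hD, PW.sat_notOutput hc hD (.inl hK)⟩⟩

theorem ggpw_detects {tree : ℕ → BTree (Option (Fin N))}
    (hD : (P.watchdog opt both tree).TreesOK) : P.Detects (P.ggpw opt both tree) := by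
  intro c hc hK
  have hT := hornClosed_up id (F := (P.watchdog opt both tree).formula)
    (F' := P.ggpw opt both tree) (A := chosen c _) (by simp [CNF.rename, ggpw])
  obtain ⟨L, hL, h⟩ := PW.exists_output hc hD
    (fun i _ x hx => .assumed _ ⟨i, x, hx, rfl⟩) hT hK
  refine ⟨L ++ [], List.mem_append_right _ (h []), fun l hl => ?_⟩
  rw [List.append_nil] at hl
  obtain ⟨w, rfl, hw⟩ := hL l hl
  exact hw

theorem glpw_sound (hq : ∀ x, P.q x ≤ P.K) {tree : Fin n → ℕ → BTree (Option (Fin N))}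
    (hD : ∀ x, (P.localWatchdog opt both (tree x) x).TreesOK) :
    P.Sound (P.glpw opt both tree) := by
  intro c hc hK
  refine ⟨fun v => (P.localWatchdog opt both (tree v.1) v.1).model c (Sum.inr v.2), ?_⟩
  intro cl hcl
  obtain ⟨x, -, hcl⟩ := List.mem_flatMap.1 hcl
  refine (?_ : CNF.Sat _ _) cl hcl
  rw [CNF.sat_rename, CNF.sat_append]
  have hmodel : (Sum.elim (P.assignment c)
      (fun v : Fin n × PWVar N =>
        (P.localWatchdog opt both (tree v.1) v.1).model c (Sum.inr v.2)) ∘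
      Sum.map id (Prod.mk x)) = (P.localWatchdog opt both (tree x) x).model c := by
    -- The joint model restricts to the model of the watchdog of `x` on its renamed copy.
    ext (y | v) <;> rfl
  rw [hmodel]
  refine ⟨PW.sat_formula hc (hD x), PW.sat_notOutput hc (hD x) ?_⟩
  by_cases hx : P.assignment c x = true
  · left
    have := Finset.sum_erase_add Finset.univ (P.load c) (Finset.mem_univ (P.grp x))
    rw [load_of_assignment hx] at this
    have := hq x
    change ∑ i ∈ Finset.univ.erase (P.grp x), P.load c i ≤ P.K - P.q x
    omega
  · exact .inr ⟨_, List.mem_singleton_self _, Bool.eq_false_of_not_eq_true hx⟩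

/-- The watchdog of `x` reads only other groups, whose chosen variables are propagated outright.
Their load exceeds `K - P.q x`, so its output clause leaves only the negation of `x`. -/
theorem glpw_refutes (hq : ∀ x, P.q x ≤ P.K) {tree : Fin n → ℕ → BTree (Option (Fin N))}
    (hD : ∀ x, (P.localWatchdog opt both (tree x) x).TreesOK) :
    P.Refutes (P.glpw opt both tree) := by
  intro A g c x hc hx hK hder
  have hsub : ((P.localWatchdog opt both (tree x) x).formula ++
      (P.localWatchdog opt both (tree x) x).notOutput [neg (Sum.inl x)]).rename
        (Sum.map id (Prod.mk x)) ⊆ P.glpw opt both tree :=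
    fun cl hcl => List.mem_flatMap.2 ⟨x, List.mem_finRange x, hcl⟩
  have hT := hornClosed_up (Sum.map id (Prod.mk x))
    (F := (P.localWatchdog opt both (tree x) x).formula) (F' := P.glpw opt both tree) (A := A)
    (fun cl hcl => hsub (by
      rw [CNF.rename, List.map_append]
      exact List.mem_append_left _ hcl))
  obtain ⟨L, hL, h⟩ := PW.exists_output (D := P.localWatchdog opt both (tree x) x) hc (hD x)
    (fun i hi y hy => by
      have := hder i y hy
      rwa [decide_eq_false (Finset.ne_of_mem_erase hi), CNF.der_false] at this) hT (by
      have := Finset.sum_erase_add Finset.univ (P.load c) (Finset.mem_univ (P.grp x))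
      rw [load_of_eq_some hx] at this
      change P.K - P.q x < ∑ i ∈ Finset.univ.erase (P.grp x), P.load c i
      have := hq x
      omega)
  have hmem : (L ++ [neg (Sum.inl x)]).map (Literal.rename (Sum.map id (Prod.mk x))) ∈
      P.glpw opt both tree :=
    hsub (List.mem_map.2 ⟨_, List.mem_append_right _ (h _), rfl⟩)
  have hup : ∀ l ∈ L, CNF.UP (P.glpw opt both tree) A
      (l.rename (Sum.map id (Prod.mk x))).compl := fun l hl => by
    obtain ⟨w, rfl, hw⟩ := hL l hl
    exact hw
  -- If `x` has been propagated, the output clause is falsified; otherwise it propagates the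
  -- negation of `x`, and the link carries this to `g`.
  rcases hder _ _ hx with hup' | ⟨-, himp⟩
  · refine .inr ⟨_, hmem, fun l' hl' => ?_⟩
    obtain ⟨l, hl, rfl⟩ := List.mem_map.1 hl'
    rcases List.mem_append.1 hl with hl | hl
    · exact hup l hl
    · rw [List.mem_singleton.1 hl]
      exact hup'
  · refine .inl (himp (.propagated _ _ hmem (List.mem_map.2 ⟨neg (Sum.inl x), by simp, rfl⟩)
      fun l' hl' hne => ?_))
    obtain ⟨l, hl, rfl⟩ := List.mem_map.1 hl'
    rcases List.mem_append.1 hl with hl | hl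
    · exact hup l hl
    · rw [List.mem_singleton.1 hl] at hne
      exact absurd rfl hne

end PBAMO

/-- The conjunctions of the MDD, GSWC, GGT, RGGT and GLPW encodings of a PB(AMO) constraint with a GAC
encoding of its AMO constraints are GAC encodings of it, and the conjunction of the GGPW encoding
with a CC encoding of the AMO constraints is a CC encoding. The order of the groups, the trees, and
the implementation choices of the polynomial watchdogs are arbitrary. -/
theorem mainTheorem1 {n N : ℕ} {β : Type*} (P : PBAMO n N) (hP : P.Normalised)
    (H : CNF (Fin n ⊕ β)) :
    (IsGACEncoding H P.amos →
      IsGACEncoding (P.mdd.conj H) P.constraint ∧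
      IsGACEncoding (P.gswc.conj H) P.constraint ∧
      (∀ t : BTree (Fin N), t.leaves.Perm (List.finRange N) →
        IsGACEncoding ((P.ggt t).conj H) P.constraint) ∧
      (∀ build : PBAMO n N → BTree (Fin N),
        (∀ Q : PBAMO n N, Q.liveGroups ≠ [] → (build Q).leaves.Perm Q.liveGroups) →
        IsGACEncoding ((P.rggt build).conj H) P.constraint) ∧
      (∀ (opt both : Bool) (tree : Fin n → ℕ → BTree (Option (Fin N))),
        (∀ x, (P.localWatchdog opt both (tree x) x).TreesOK) →
        IsGACEncoding ((P.glpw opt both tree).conj H) P.constraint)) ∧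
    (IsCCEncoding H P.amos →
      ∀ (opt both : Bool) (tree : ℕ → BTree (Option (Fin N))),
        (P.watchdog opt both tree).TreesOK →
        IsCCEncoding ((P.ggpw opt both tree).conj H) P.constraint) := by
  refine ⟨fun hH => ⟨?_, ?_, fun t ht => ?_, fun build hb => ?_, fun opt both tree hD => ?_⟩,
    fun hH opt both tree hD => ?_⟩
  · exact PBAMO.isGACEncoding_conj PBAMO.mdd_sound PBAMO.mdd_refutes hH
  · exact PBAMO.isGACEncoding_conj PBAMO.gswc_sound (PBAMO.gswc_refutes hP.q_le) hH
  · exact PBAMO.isGACEncoding_conj (PBAMO.ggt_sound ht) (PBAMO.ggt_refutes hP.q_le ht) hH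
  · obtain ⟨hs, hr⟩ := PBAMO.rggt_sound_refutes hP hb
    exact PBAMO.isGACEncoding_conj hs hr hH
  · exact PBAMO.isGACEncoding_conj (PBAMO.glpw_sound hP.q_le hD)
      (PBAMO.glpw_refutes hP.q_le hD) hH
  · exact PBAMO.isCCEncoding_conj (PBAMO.ggpw_sound hD) (PBAMO.ggpw_detects hD) hH
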